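/- A \emph{cluster graph} is a graph without an induced path $P_3$ on three vertices, i.e. a disjoint union of cliques. A set $X\subseteq V(G)$ is a \emph{cluster deletion set} of $G$ if $G\setminus X$ (the subgraph induced on $V(G)\setminus X$) is a cluster graph. In \textsc{Cluster Vertex Deletion} parameterized by vertex cover size $K$, the input is a graph $G$ on $n$ known vertices that has a vertex cover of size at most $K$, together with $n$, $K$ and an integer $0\le k\le K$; the answer is a cluster deletion set of $G$ of size at most $k$ if one exists, and \textsc{Null} otherwise. In the \emph{dynamic edge arrival} (DEA) model, the input is a sequence of insertions of absent edges and deletions of present edges which starts at the empty graph and ends at $G$. The space of a streaming algorithm is the number of bits that it keeps in memory between stream elements, including all random choices that it uses later. \textbf{Theorem.} (i) There is a randomized one-pass streaming algorithm in the DEA model which solves \textsc{Cluster Vertex Deletion} with probability at least $2/3$ on every input, and whose space is $O(K^2\log^4 n)$ bits (at all times and for all random choices). (ii) For every $c\in\mathbb N$ there are positive integers $\alpha,\beta$ and a $c'\in\mathbb N$ such that the following holds for all $n,K$ and every graph $G$ on $n$ vertices that has a vertex cover of size at most $K$. Let $h_i:V(G)\to[\beta K]$, $1\le i\le \alpha\lfloor\log_2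 n\rfloor$, be independent random functions, each drawn from a pairwise independent hash family (i.e. $\Pr[h_i(a)=h_i(b)]\le \frac1{\beta K}$ for all $a\ne b$). For each $i$ and each unordered pair $\{r,s\}$ with $r,s\in[\beta K]$, let an $\ell_0$-sampler with failure probability $n^{-c'}$ be run on the edges $uv$ of $G$ with $\{h_i(u),h_i(v)\}=\{r,s\}$; that is, given the hash functions, its output is with probability at least $1-n^{-c'}$ a uniformly random edge of this set, and it is \textsc{Null} if the set is empty. Let $H$ be the graph on $V(G)$ whose edges are the outputs of all these samplers. Then with probability at least $1-n^{-c}$, for all $X\subseteq V(G)$ with $|X|\le K$: $X$ is a cluster deletion set of $H$ if and only if it is one of $G$. -/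

import Mathlib

open MeasureTheory ProbabilityTheory

/-! ### Cluster graphs and the problem Cluster Vertex Deletion -/

/-- A cluster graph: a disjoint union of cliques, i.e. no three vertices induce a path `P₃`. -/
def IsClusterGraph {V : Type*} (G : SimpleGraph V) : Prop :=
  ∀ u v w : V, G.Adj u v → G.Adj v w → u ≠ w → G.Adj u w

/-- `X` is a cluster deletion set of `G`: the graph `G ∖ X` is a cluster graph. -/
def IsClusterDeletionSet {n : ℕ} (G : SimpleGraph (Fin n)) (X : Finset (Fin n)) : Prop :=
  IsClusterGraph (G.induce ((X : Set (Fin n))ᶜ))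

/-! ### Dynamic edge arrival streams -/

/-- One stream element: the two endpoints of an edge, and `true` for "insert", `false` for
"delete". Vertices are numbered `0, …, n - 1`. -/
abbrev StreamToken : Type := ℕ × ℕ × Bool

/-- `IsDynamicStream s G`: `s` is a sequence of edge insertions and deletions that, started at the
empty graph on `n` vertices, ends in the graph `G`. Only absent edges are inserted and only present
edges are deleted; the order of the endpoints in a stream element is arbitrary. -/
inductive IsDynamicStream {n : ℕ} : List StreamToken → SimpleGraph (Fin n) → Prop
  | nil : IsDynamicStream [] ⊥
  | insert {s : List StreamToken} {G : SimpleGraph (Fin n)} (u v : Fin n) :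
      IsDynamicStream s G → u ≠ v → ¬ G.Adj u v →
        IsDynamicStream (s ++ [((u : ℕ), (v : ℕ), true)]) (G ⊔ SimpleGraph.edge u v)
  | delete {s : List StreamToken} {G : SimpleGraph (Fin n)} (u v : Fin n) :
      IsDynamicStream s G → G.Adj u v →
        IsDynamicStream (s ++ [((u : ℕ), (v : ℕ), false)]) (G.deleteEdges {s(u, v)})

/-! ### Randomized one-pass streaming algorithms -/

/-- The numbers known to the algorithm in advance: `(n, K, k)`, the number of vertices, the
structural parameter and the solution size. -/
abbrev StreamParams : Type := ℕ × ℕ × ℕ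

/-- A randomized one-pass streaming algorithm. A single program serves all `(n, K, k)`. The memory
content is a binary word, given as a natural number. A seed is drawn uniformly
from `{0, …, seedCount - 1}` before the stream starts and determines the initial memory content;
from then on only the memory is available, so random choices that are used later occupy memory. -/
structure StreamingAlgorithm where
  /-- number of possible seeds -/
  seedCount : StreamParams → ℕ
  /-- initial memory content -/
  start : StreamParams → ℕ → ℕ
  /-- memory content after reading one stream element -/
  update : StreamParams → ℕ → StreamToken → ℕ
  /-- answer computed from the final memory content: a list of vertices, or `none` (Null) -/
  output : StreamParams → ℕ → Option (List ℕ)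
  seedCount_pos : ∀ p, 0 < seedCount p
  computable_seedCount : Computable seedCount
  computable_start : Computable fun x : StreamParams × ℕ => start x.1 x.2
  computable_update :
    Computable fun x : StreamParams × ℕ × StreamToken => update x.1 x.2.1 x.2.2
  computable_output : Computable fun x : StreamParams × ℕ => output x.1 x.2

/-- The memory content after one pass over `s`, with seed `ω`. -/
def StreamingAlgorithm.run (A : StreamingAlgorithm) (p : StreamParams) (ω : ℕ)
    (s : List StreamToken) : ℕ :=
  s.foldl (A.update p) (A.start p ω)

/-- A parameterized graph problem whose instances are graphs on `n` vertices with the numbers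
`K` (parameter) and `k`; an answer is a list of vertices or `none`. -/
structure ParamGraphProblem where
  /-- the admissible instances -/
  instances : (n K k : ℕ) → SimpleGraph (Fin n) → Prop
  /-- the correct answers -/
  correct : (n K k : ℕ) → SimpleGraph (Fin n) → Option (List ℕ) → Prop

/-- The problem is streamable in the dynamic edge arrival model in one pass with `O(f(n, K))` bits:
for one algorithm and one constant `C`, on every dynamic stream of every instance, at most
`C * f n K` bits of memory are in use at all times (whatever the seed), and the answer is correct
with probability at least `2/3`. -/
def IsDEAStreamable (Q : ParamGraphProblem) (f : ℕ → ℕ → ℝ) : Prop :=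
  ∃ (A : StreamingAlgorithm) (C : ℝ), ∀ (n K k : ℕ) (G : SimpleGraph (Fin n))
    (s : List StreamToken), Q.instances n K k G → IsDynamicStream s G →
      (∀ ω < A.seedCount (n, K, k), ∀ t : List StreamToken, t <+: s →
        ((A.run (n, K, k) ω t).size : ℝ) ≤ C * f n K) ∧
      (2 / 3 : ℝ) ≤
        ({ω : ℕ | ω < A.seedCount (n, K, k) ∧
            Q.correct n K k G (A.output (n, K, k) (A.run (n, K, k) ω s))}.ncard : ℝ) /
          (A.seedCount (n, K, k) : ℝ)

/-- Cluster Vertex Deletion parameterized by the vertex cover size: the input graph has a vertex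
cover of size at most `K`, and `k ≤ K`. The answer is a cluster deletion set of at most `k`
vertices if there is one, and `none` otherwise. -/
def clusterVertexDeletion : ParamGraphProblem where
  instances _ K k G := G.vertexCoverNum ≤ K ∧ k ≤ K
  correct n _ k G out :=
    match out with
    | some l => ∃ X : Finset (Fin n), l.toFinset = X.map Fin.valEmbedding ∧
        X.card ≤ k ∧ IsClusterDeletionSet G X
    | none => ¬ ∃ X : Finset (Fin n), X.card ≤ k ∧ IsClusterDeletionSet G X

/-! ### Edge sampling with pairwise independent hashing and `ℓ₀`-samplers -/

/-- The random function `h : [n] → [m]` is drawn from a pairwise independent hash family: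
two distinct points collide with probability at most `1 / m`. -/
def IsPairwiseHash {Ω : Type*} [MeasurableSpace Ω] (P : Measure Ω) {n m : ℕ}
    (h : Ω → Fin n → Fin m) : Prop :=
  Measurable h ∧ ∀ a b : Fin n, a ≠ b → P.real {ω | h ω a = h ω b} ≤ 1 / (m : ℝ)

/-- Given the event `B`, the random variable `L` is the output of an `ℓ₀`-sampler with failure
probability `δ` for the edge set `E`: with probability at least `1 - δ` it is an
edge drawn uniformly from `E` (so each `e ∈ E` appears with conditional probability at least
`(1 - δ) / |E|`), and it is `none` if `E` is empty. -/
def IsL0SamplerOutput {Ω : Type*} [MeasurableSpace Ω] (P : Measure Ω) {n : ℕ} (B : Set Ω) (δ : ℝ)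
    (E : Set (Sym2 (Fin n))) (L : Ω → Option (Sym2 (Fin n))) : Prop :=
  (∀ o, MeasurableSet (L ⁻¹' {o})) ∧
  (∀ e ∈ E, (1 - δ) / (E.ncard : ℝ) * P.real B ≤ P.real (B ∩ {ω | L ω = some e})) ∧
  (E = ∅ → P (B ∩ {ω | L ω ≠ none}) = 0)

/-- The edges of `G` whose endpoints receive from `h` the unordered pair `q` of hash values. -/
def hashBucket {n m : ℕ} (G : SimpleGraph (Fin n)) (h : Fin n → Fin m) (q : Sym2 (Fin m)) :
    Set (Sym2 (Fin n)) :=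
  {e ∈ G.edgeSet | e.map h = q}

/-- The sampling scheme on `G`: independent pairwise independent hash functions
`h 0, …, h (t - 1) : [n] → [m]`, and for each `i` and each unordered pair `q` of hash values an
`ℓ₀`-sampler `L i q`, with failure probability `δ`, for the edges of `G` in the bucket `q` of `h i`.
The sampler guarantee holds conditionally on the choice of the hash functions; nothing is assumed on
the joint behaviour of different samplers. -/
structure IsEdgeSampling {Ω : Type*} [MeasurableSpace Ω] (P : Measure Ω) {n m t : ℕ}
    (G : SimpleGraph (Fin n)) (δ : ℝ) (h : Fin t → Ω → Fin n → Fin m)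
    (L : Fin t → Sym2 (Fin m) → Ω → Option (Sym2 (Fin n))) : Prop where
  hash : ∀ i, IsPairwiseHash P (h i)
  indep : iIndepFun h P
  sampler : ∀ (η : Fin t → Fin n → Fin m) (i : Fin t) (q : Sym2 (Fin m)),
    IsL0SamplerOutput P {ω | ∀ j, h j ω = η j} δ (hashBucket G (η i) q) (L i q)

/-- The sampled graph: its edges are the outputs of all samplers. -/
def sampledGraph {Ω : Type*} {n m t : ℕ}
    (L : Fin t → Sym2 (Fin m) → Ω → Option (Sym2 (Fin n))) (ω : Ω) : SimpleGraph (Fin n) :=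
  SimpleGraph.fromEdgeSet {e | ∃ i q, L i q ω = some e}

/-! ### Cluster deletion sets and vertices of large degree -/

section Combinatorics

open scoped Classical

variable {n m K : ℕ} {G F H : SimpleGraph (Fin n)} {C X : Finset (Fin n)} {W : Set (Fin n)}

/-! Let `C` be a vertex cover and `X` a cluster deletion set, both of size at most `K`. For `u ∉ X`,
the neighbours of `u` outside `X` form a clique together with `u`. A vertex cover misses at most one
vertex of a clique, so `u` has degree at most `2 K`. Vertices of larger degree are therefore forced
into `X`, and their edges carry no further information: it suffices to know a set `W` of such
vertices and all edges outside `W` (`isClusterDeletionSet_iff_of_sparsification`).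

Hashing into `O(K)` values finds both. If `u` and `v` are adjacent and have degree at most `5 K`, a
random function is likely to separate each of them from the rest of `C ∪ N(u) ∪ N(v)`; since every
edge meets `C`, the edge `uv` is then alone in its bucket. If `u` has degree above `5 K`, it is
likely that more than `3 K` neighbours of `u` are isolated, and their buckets are distinct and
contain only edges at `u`. Either event fails with probability at most `1 / 16`, so logarithmically
many independent functions and a union bound suffice.

For the sampled graph `H` it only matters that each sampler returns some edge of its bucket. Light
edges are all present, and heavy vertices keep degree above `3 K`. Since `C` also covers `H`, heavy
vertices are forced by `H` as well (`isClusterDeletionSet_iff_of_degree`).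

The streaming algorithm uses no samplers. It stores for each bucket the sum of the codes of its
edges, which is linear and hence easy to maintain under deletions. Codes lie in `[n², 2 n²)`, so a
sum reveals whether the bucket is empty and, if it is a singleton, its edge. A vertex is declared
heavy by a majority vote on whether its row has more than `3 K` occupied buckets. This is reliable
for degree above `5 K` and for degree at most `2 K`; in between, either verdict is harmless
(`correct_sketchAnswer`). The answer is then found by exhaustive search. -/

lemma isClusterDeletionSet_iff : IsClusterDeletionSet G X ↔
    ∀ u v w, u ∉ X → v ∉ X → w ∉ X → G.Adj u v → G.Adj v w → u ≠ w → G.Adj u w := by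
  constructor
  · intro h u v w hu hv hw huv hvw huw
    exact h ⟨u, by simpa using hu⟩ ⟨v, by simpa using hv⟩ ⟨w, by simpa using hw⟩ huv hvw
      (by simpa using huw)
  · rintro h ⟨u, hu⟩ ⟨v, hv⟩ ⟨w, hw⟩ huv hvw huw
    exact h u v w (by simpa using hu) (by simpa using hv) (by simpa using hw) huv hvw
      (by simpa using huw)

/-- A graph with a vertex cover of size at most `K` has small degrees outside of every
cluster deletion set of size at most `K`. -/
lemma degree_le_of_notMem_clusterDeletionSet (hC : G.IsVertexCover (C : Set (Fin n)))
    (hCK : C.card ≤ K) (hXK : X.card ≤ K) (hX : IsClusterDeletionSet G X) {u : Fin n}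
    (hu : u ∉ X) : G.degree u ≤ 2 * K := by
  rw [isClusterDeletionSet_iff] at hX
  set N := G.neighborFinset u with hN
  have h1 : (N \ X).card ≤ C.card := by
    by_cases hsub : N \ X ⊆ C
    · exact Finset.card_le_card hsub
    · obtain ⟨y, hy, hyC⟩ := Finset.not_subset.1 hsub
      simp only [hN, Finset.mem_sdiff, SimpleGraph.mem_neighborFinset] at hy
      have huC : u ∈ C := by
        rcases hC hy.1 with h | h
        · exact h
        · exact absurd h hyC
      -- Trading the one uncovered neighbour `y` for `u` keeps the cardinality: every other
      -- remaining neighbour is adjacent to `y`, hence lies in `C`.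
      have hsub' : insert u ((N \ X).erase y) ⊆ C := by
        intro z hz
        rcases Finset.mem_insert.1 hz with rfl | hz
        · exact huC
        · simp only [hN, Finset.mem_erase, Finset.mem_sdiff, SimpleGraph.mem_neighborFinset] at hz
          have := hX y u z hy.2 hu hz.2.2 hy.1.symm hz.2.1 (Ne.symm hz.1)
          rcases hC this with h | h
          · exact absurd h hyC
          · exact h
      have h2 := Finset.card_le_card hsub'
      rw [Finset.card_insert_of_notMem (by simp [hN]),
        Finset.card_erase_add_one (by simp [hN, hy])] at h2
      exact h2
  have h3 : N.card ≤ (N \ X).card + X.card := by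
    have := Finset.card_le_card_sdiff_add_card (s := N) (t := X)
    omega
  rw [← SimpleGraph.card_neighborFinset_eq_degree, ← hN]
  omega

/-- If `F` contains all edges of `G` outside of a set `W` of vertices of large degree,
then `W` and `F` determine the small cluster deletion sets of `G`. -/
lemma isClusterDeletionSet_iff_of_sparsification (hC : G.IsVertexCover (C : Set (Fin n)))
    (hCK : C.card ≤ K) (hXK : X.card ≤ K) (hFG : F ≤ G)
    (hW : ∀ w ∈ W, 2 * K < G.degree w)
    (hF : ∀ u v, G.Adj u v → u ∉ W → v ∉ W → F.Adj u v) :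
    IsClusterDeletionSet G X ↔ (∀ w ∈ W, w ∈ X) ∧ IsClusterDeletionSet F X := by
  have key (hWX : ∀ w ∈ W, w ∈ X) :
      IsClusterDeletionSet G X ↔ IsClusterDeletionSet F X := by
    have e (u v) (hu : u ∉ X) (hv : v ∉ X) : G.Adj u v ↔ F.Adj u v :=
      ⟨fun h => hF u v h (fun h' => hu (hWX u h')) (fun h' => hv (hWX v h')), fun h => hFG h⟩
    rw [isClusterDeletionSet_iff, isClusterDeletionSet_iff]
    refine forall₃_congr fun u v w => forall₃_congr fun hu hv hw => ?_
    rw [e u v hu hv, e v w hv hw, e u w hu hw]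
  constructor
  · intro h
    have hWX : ∀ w ∈ W, w ∈ X := by
      intro w hw
      by_contra hwX
      have := degree_le_of_notMem_clusterDeletionSet hC hCK hXK h hwX
      have := hW w hw
      omega
    exact ⟨hWX, (key hWX).1 h⟩
  · rintro ⟨hWX, h⟩
    exact (key hWX).2 h

/-- A subgraph which contains all edges between vertices of small degree, and in which the other
vertices keep a large degree, has the same small cluster deletion sets. -/
lemma isClusterDeletionSet_iff_of_degree (hC : G.IsVertexCover (C : Set (Fin n)))
    (hCK : C.card ≤ K) (hXK : X.card ≤ K) (hHG : H ≤ G)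
    (hlight : ∀ u v, G.Adj u v → G.degree u ≤ 5 * K → G.degree v ≤ 5 * K → H.Adj u v)
    (hheavy : ∀ u, 5 * K < G.degree u → 2 * K < H.degree u) :
    IsClusterDeletionSet H X ↔ IsClusterDeletionSet G X := by
  -- With this `W`, the condition `W ⊆ X` is automatic once `X` works for `H`, because `C` is a
  -- vertex cover of `H` too.
  rw [isClusterDeletionSet_iff_of_sparsification (F := H) (W := {u | 2 * K < H.degree u})
    hC hCK hXK hHG]
  · refine ⟨fun h => ⟨fun w hw => ?_, h⟩, fun h => h.2⟩
    by_contra hwX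
    have := degree_le_of_notMem_clusterDeletionSet (hC.mono hHG) hCK hXK h hwX
    exact absurd hw (by simpa using this)
  · intro w hw
    exact lt_of_lt_of_le hw (SimpleGraph.degree_le_of_le hHG)
  · intro u v huv hu hv
    refine hlight u v huv ?_ ?_
    · by_contra hcon
      exact hu (hheavy u (by omega))
    · by_contra hcon
      exact hv (hheavy v (by omega))

/-! ### Buckets of isolated vertices -/

/-- `s` shares its hash value with no other element of `T`. -/
def HashIsolated (h : Fin n → Fin m) (T : Finset (Fin n)) (s : Fin n) : Prop :=
  ∀ x ∈ T, x ≠ s → h x ≠ h s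

lemma mk_mem_hashBucket {h : Fin n → Fin m} {x y : Fin n} {q : Sym2 (Fin m)} :
    s(x, y) ∈ hashBucket G h q ↔ G.Adj x y ∧ s(h x, h y) = q := by
  simp [hashBucket]

/-- Any edge in the bucket has an endpoint in `C`, and isolation identifies that endpoint with `u`
or `v`. The other endpoint is then a neighbour of it, and isolation identifies it as well. -/
lemma hashBucket_eq_singleton {h : Fin n → Fin m} (hC : G.IsVertexCover (C : Set (Fin n)))
    {u v : Fin n} (huv : G.Adj u v)
    (hu : HashIsolated h (C ∪ G.neighborFinset u ∪ G.neighborFinset v) u)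
    (hv : HashIsolated h (C ∪ G.neighborFinset u ∪ G.neighborFinset v) v) :
    hashBucket G h s(h u, h v) = {s(u, v)} := by
  have main : ∀ x y, G.Adj x y → x ∈ C → s(h x, h y) = s(h u, h v) → s(x, y) = s(u, v) := by
    intro x y hxy hx he
    rcases Sym2.eq_iff.1 he with ⟨h1, h2⟩ | ⟨h1, h2⟩
    · have hxu : x = u := by
        by_contra hne
        exact hu x (by simp [hx]) hne h1
      subst hxu
      have hyv : y = v := by
        by_contra hne
        exact hv y (by simp [hxy]) hne h2
      rw [hyv]
    · have hxv : x = v := by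
        by_contra hne
        exact hv x (by simp [hx]) hne h1
      subst hxv
      have hyu : y = u := by
        by_contra hne
        exact hu y (by simp [hxy]) hne h2
      rw [hyu, Sym2.eq_swap]
  ext e
  induction e using Sym2.ind with
  | _ x y =>
    rw [mk_mem_hashBucket, Set.mem_singleton_iff]
    constructor
    · rintro ⟨hxy, he⟩
      rcases hC hxy with hx | hy
      · exact main x y hxy hx he
      · rw [Sym2.eq_swap]
        exact main y x hxy.symm hy (by rw [Sym2.eq_swap, he])
    · intro he
      rcases Sym2.eq_iff.1 he with ⟨rfl, rfl⟩ | ⟨rfl, rfl⟩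
      · exact ⟨huv, rfl⟩
      · exact ⟨huv.symm, Sym2.eq_swap⟩

/-- The edges in the bucket of `u` and an isolated neighbour `s` outside of the vertex cover are
incident with `u`. -/
lemma exists_adj_of_mem_hashBucket {h : Fin n → Fin m}
    (hC : G.IsVertexCover (C : Set (Fin n))) {u s : Fin n} (hu : HashIsolated h C u)
    (hsC : s ∉ C) (hs : HashIsolated h C s) {e : Sym2 (Fin n)}
    (he : e ∈ hashBucket G h s(h u, h s)) : ∃ y, G.Adj u y ∧ h y = h s ∧ e = s(u, y) := by
  have main : ∀ x y, G.Adj x y → x ∈ C → s(h x, h y) = s(h u, h s) →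
      ∃ z, G.Adj u z ∧ h z = h s ∧ s(x, y) = s(u, z) := by
    intro x y hxy hx he
    rcases Sym2.eq_iff.1 he with ⟨h1, h2⟩ | ⟨h1, h2⟩
    · have hxu : x = u := by
        by_contra hne
        exact hu x hx hne h1
      subst hxu
      exact ⟨y, hxy, h2, rfl⟩
    -- The covered endpoint cannot play the role of `s`, which lies outside `C` and collides with
    -- nothing in `C`.
    · exact absurd h1 (hs x hx (fun h => hsC (h ▸ hx)))
  induction e using Sym2.ind with
  | _ x y =>
    rw [mk_mem_hashBucket] at he
    rcases hC he.1 with hx | hy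
    · exact main x y he.1 hx he.2
    · rw [Sym2.eq_swap]
      exact main y x he.1.symm hy (by rw [Sym2.eq_swap, he.2])

/-- The values `r` such that the bucket `{h v, r}` is not empty. -/
noncomputable def occupiedRow (G : SimpleGraph (Fin n)) (h : Fin n → Fin m) (v : Fin n) :
    Finset (Fin m) :=
  Finset.univ.filter fun r => (hashBucket G h s(h v, r)).Nonempty

/-- An edge in the row of `v` either has its covered endpoint at `v`, so that `r` is the value of a
neighbour of `v`, or `r` is itself the value of a covered vertex. At degree at most `2 K` and with
`C.card ≤ K` this gives the upper side of the `3 K` threshold test. -/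
lemma card_occupiedRow_le {h : Fin n → Fin m} (hC : G.IsVertexCover (C : Set (Fin n)))
    {v : Fin n} (hv : HashIsolated h C v) :
    (occupiedRow G h v).card ≤ C.card + G.degree v := by
  have main : ∀ x y r, G.Adj x y → x ∈ C → s(h x, h y) = s(h v, r) →
      r ∈ (C ∪ G.neighborFinset v).image h := by
    intro x y r hxy hx he
    rcases Sym2.eq_iff.1 he with ⟨h1, h2⟩ | ⟨h1, h2⟩
    · have hxu : x = v := by
        by_contra hne
        exact hv x hx hne h1
      subst hxu
      exact Finset.mem_image.2 ⟨y, by simp [hxy], h2⟩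
    · exact Finset.mem_image.2 ⟨x, by simp [hx], h1⟩
  have hsub : occupiedRow G h v ⊆ (C ∪ G.neighborFinset v).image h := by
    intro r hr
    obtain ⟨e, he⟩ := (Finset.mem_filter.1 hr).2
    induction e using Sym2.ind with
    | _ x y =>
      rw [mk_mem_hashBucket] at he
      rcases hC he.1 with hx | hy
      · exact main x y r he.1 hx he.2
      · exact main y x r he.1.symm hy (by rw [Sym2.eq_swap, he.2])
  calc (occupiedRow G h v).card ≤ ((C ∪ G.neighborFinset v).image h).card :=
        Finset.card_le_card hsub
    _ ≤ (C ∪ G.neighborFinset v).card := Finset.card_image_le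
    _ ≤ C.card + (G.neighborFinset v).card := Finset.card_union_le _ _
    _ = _ := by rw [SimpleGraph.card_neighborFinset_eq_degree]

lemma injOn_hashIsolated (h : Fin n → Fin m) (S T : Finset (Fin n)) (hST : S ⊆ T) :
    Set.InjOn h (S.filter fun s => HashIsolated h T s) := by
  intro x hx y hy hxy
  simp only [Finset.coe_filter, Set.mem_ofPred_eq] at hx hy
  by_contra hne
  exact hy.2 x (hST hx.1) hne hxy

/-- Isolated neighbours have distinct hash values, each of which is occupied by the edge to `v`.
This is the lower side of the threshold test. -/
lemma card_isolated_le_card_occupiedRow {h : Fin n → Fin m} {v : Fin n} {S T : Finset (Fin n)}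
    (hST : S ⊆ T) (hS : S ⊆ G.neighborFinset v) :
    (S.filter fun s => HashIsolated h T s).card ≤ (occupiedRow G h v).card := by
  rw [← Finset.card_image_of_injOn (injOn_hashIsolated h S T hST)]
  refine Finset.card_le_card fun r hr => ?_
  obtain ⟨s, hs, rfl⟩ := Finset.mem_image.1 hr
  have hsv : G.Adj v s := by simpa using hS (Finset.mem_filter.1 hs).1
  exact Finset.mem_filter.2 ⟨Finset.mem_univ _, s(v, s), mk_mem_hashBucket.2 ⟨hsv, rfl⟩⟩

/-- A vertex of large degree has many neighbours outside of a small vertex cover. -/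
lemma exists_neighbors_outside (hCK : C.card ≤ K) {u : Fin n} (hu : 5 * K < G.degree u) :
    ∃ S ⊆ G.neighborFinset u \ C, S.card = 4 * K + 1 := by
  refine Finset.exists_subset_card_eq ?_
  have h1 := Finset.card_le_card_sdiff_add_card (s := G.neighborFinset u) (t := C)
  rw [SimpleGraph.card_neighborFinset_eq_degree] at h1
  omega

lemma exists_finset_isVertexCover (h : G.vertexCoverNum ≤ K) :
    ∃ C : Finset (Fin n), G.IsVertexCover (C : Set (Fin n)) ∧ C.card ≤ K := by
  obtain ⟨s, hs, hcov⟩ := G.vertexCoverNum_exists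
  refine ⟨s.toFinset, by simpa using hcov, ?_⟩
  rw [← hs, Set.encard_eq_coe_toFinset_card] at h
  exact_mod_cast h

end Combinatorics

/-! ### The probability that a random hash function is bad for an edge or a vertex -/

section HashProbability

open scoped Classical

variable {Ω : Type*} [MeasurableSpace Ω] {P : Measure Ω} [IsProbabilityMeasure P] {n m K : ℕ}
  {h : Ω → Fin n → Fin m} {κ : ℝ} {G : SimpleGraph (Fin n)} {C : Finset (Fin n)}

lemma measureReal_not_hashIsolated_le
    (hκ : ∀ a b, a ≠ b → P.real {ω | h ω a = h ω b} ≤ κ) (hκ0 : 0 ≤ κ)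
    (T : Finset (Fin n)) (s : Fin n) :
    P.real {ω | ¬ HashIsolated (h ω) T s} ≤ T.card * κ := by
  have hsub : {ω | ¬ HashIsolated (h ω) T s} ⊆
      ⋃ x ∈ T.filter (· ≠ s), {ω | h ω x = h ω s} := by
    intro ω hω
    simp only [HashIsolated, Set.mem_ofPred_eq, not_forall, not_not] at hω
    obtain ⟨x, hx, hxs, he⟩ := hω
    simp only [Set.mem_iUnion]
    exact ⟨x, Finset.mem_filter.2 ⟨hx, hxs⟩, he⟩
  calc P.real {ω | ¬ HashIsolated (h ω) T s}
      ≤ P.real (⋃ x ∈ T.filter (· ≠ s), {ω | h ω x = h ω s}) :=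
        measureReal_mono hsub (measure_ne_top _ _)
    _ ≤ ∑ x ∈ T.filter (· ≠ s), P.real {ω | h ω x = h ω s} :=
        measureReal_biUnion_finset_le _ _
    _ ≤ ∑ x ∈ T.filter (· ≠ s), κ :=
        Finset.sum_le_sum fun x hx => hκ x s (Finset.mem_filter.1 hx).2
    _ = (T.filter (· ≠ s)).card * κ := by rw [Finset.sum_const, nsmul_eq_mul]
    _ ≤ T.card * κ := by gcongr; exact Finset.filter_subset _ _

/-- Markov's inequality for the number of events that occur. -/
lemma mul_measureReal_le_card_filter_le {ι : Type*} (S : Finset ι) (A : ι → Set Ω)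
    (hA : ∀ s ∈ S, MeasurableSet (A s)) (a : ℕ) :
    (a : ℝ) * P.real {ω | a ≤ (S.filter fun s => ω ∈ A s).card} ≤ ∑ s ∈ S, P.real (A s) := by
  set f : Ω → ℝ := fun ω => ∑ s ∈ S, (A s).indicator 1 ω with hf
  have hint : ∀ s ∈ S, Integrable (fun ω => (A s).indicator (1 : Ω → ℝ) ω) P := fun s hs =>
    (integrable_const (1 : ℝ)).indicator (hA s hs)
  have hf' : ∀ ω, f ω = (S.filter fun s => ω ∈ A s).card := by
    intro ω
    simp [hf, Set.indicator_apply]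
  have h1 := mul_meas_ge_le_integral_of_nonneg (μ := P) (f := f)
    (Filter.Eventually.of_forall fun ω => by rw [hf']; positivity)
    (integrable_finsetSum _ hint) (a : ℝ)
  have h2 : ∫ ω, f ω ∂P = ∑ s ∈ S, P.real (A s) := by
    rw [hf, integral_finsetSum _ hint]
    exact Finset.sum_congr rfl fun s hs => integral_indicator_one (hA s hs)
  rw [h2] at h1
  simpa [hf'] using h1

lemma measurableSet_preimage_hash (hh : Measurable h) (p : (Fin n → Fin m) → Prop) :
    MeasurableSet {ω | p (h ω)} :=
  hh (t := {η | p η}) (Set.toFinite _).measurableSet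

/-- The hash function isolates both endpoints of the edge `uv`. -/
def IsGoodForEdge (G : SimpleGraph (Fin n)) (C : Finset (Fin n)) (u v : Fin n)
    (η : Fin n → Fin m) : Prop :=
  HashIsolated η (C ∪ G.neighborFinset u ∪ G.neighborFinset v) u ∧
    HashIsolated η (C ∪ G.neighborFinset u ∪ G.neighborFinset v) v

/-- The hash function isolates `u` from the vertex cover `C`, and more than `3 K` elements of the
set `S` of neighbours of `u` from `C` and from each other. -/
def IsGoodForHeavy (K : ℕ) (C S : Finset (Fin n)) (u : Fin n) (η : Fin n → Fin m) : Prop :=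
  HashIsolated η C u ∧ 3 * K < (S.filter fun s => HashIsolated η (C ∪ S) s).card

/-- The set to be avoided has at most `K + 5 K + 5 K` elements, so each endpoint fails with
probability at most `11 / 512`. The collision bound is twice `1 / (1024 * K)` so that it also covers
the multiplicative functions of the streaming algorithm, for which only this weaker bound is proved.
-/
lemma measureReal_not_isGoodForEdge_le (hK : 0 < K)
    (hκ : ∀ a b, a ≠ b → P.real {ω | h ω a = h ω b} ≤ 1 / (512 * K)) (hCK : C.card ≤ K)
    {u v : Fin n} (hu : G.degree u ≤ 5 * K) (hv : G.degree v ≤ 5 * K) :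
    P.real {ω | ¬ IsGoodForEdge G C u v (h ω)} ≤ 1 / 16 := by
  have hK' : (0 : ℝ) < K := by exact_mod_cast hK
  set T := C ∪ G.neighborFinset u ∪ G.neighborFinset v with hT
  have hTc : T.card ≤ 11 * K := by
    have h1 := Finset.card_union_le (C ∪ G.neighborFinset u) (G.neighborFinset v)
    have h2 := Finset.card_union_le C (G.neighborFinset u)
    rw [SimpleGraph.card_neighborFinset_eq_degree, ← hT] at h1
    rw [SimpleGraph.card_neighborFinset_eq_degree] at h2
    omega
  have hκ0 : (0 : ℝ) ≤ 1 / (512 * K) := by positivity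
  have hTc' : (T.card : ℝ) ≤ 11 * K := by exact_mod_cast hTc
  have key (s : Fin n) : P.real {ω | ¬ HashIsolated (h ω) T s} ≤ 11 / 512 := by
    refine (measureReal_not_hashIsolated_le hκ hκ0 T s).trans ?_
    calc (T.card : ℝ) * (1 / (512 * K)) ≤ 11 * K * (1 / (512 * K)) := by gcongr
      _ = 11 / 512 := by field_simp
  calc P.real {ω | ¬ IsGoodForEdge G C u v (h ω)}
      ≤ P.real ({ω | ¬ HashIsolated (h ω) T u} ∪ {ω | ¬ HashIsolated (h ω) T v}) := by
        refine measureReal_mono fun ω hω => ?_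
        exact not_and_or.1 hω
    _ ≤ 11 / 512 + 11 / 512 := (measureReal_union_le _ _).trans (add_le_add (key u) (key v))
    _ ≤ 1 / 16 := by norm_num

lemma measureReal_not_hashIsolated_cover_le (hK : 0 < K)
    (hκ : ∀ a b, a ≠ b → P.real {ω | h ω a = h ω b} ≤ 1 / (512 * K)) (hCK : C.card ≤ K)
    (u : Fin n) : P.real {ω | ¬ HashIsolated (h ω) C u} ≤ 1 / 512 := by
  have hK' : (0 : ℝ) < K := by exact_mod_cast hK
  refine (measureReal_not_hashIsolated_le hκ (by positivity) C u).trans ?_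
  calc (C.card : ℝ) * (1 / (512 * K)) ≤ K * (1 / (512 * K)) := by gcongr
    _ = 1 / 512 := by field_simp

/-- Among the `4 K + 1` elements of `S`, a failure leaves at least `K + 1` that are not isolated.
Pairwise collision bounds control their expected number, and Markov's inequality does the rest
without any further independence. -/
lemma measureReal_not_isGoodForHeavy_le (hK : 0 < K) (hh : Measurable h)
    (hκ : ∀ a b, a ≠ b → P.real {ω | h ω a = h ω b} ≤ 1 / (512 * K)) (hCK : C.card ≤ K)
    {S : Finset (Fin n)} (hS : S.card = 4 * K + 1) (u : Fin n) :
    P.real {ω | ¬ IsGoodForHeavy K C S u (h ω)} ≤ 1 / 16 := by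
  have hK' : (1 : ℝ) ≤ K := by exact_mod_cast hK
  have hκ0 : (0 : ℝ) ≤ 1 / (512 * K) := by positivity
  set A : Fin n → Set Ω := fun s => {ω | ¬ HashIsolated (h ω) (C ∪ S) s} with hA
  have hcard : ((C ∪ S).card : ℝ) ≤ 5 * K + 1 := by
    have := Finset.card_union_le C S
    have : (C ∪ S).card ≤ 5 * K + 1 := by omega
    exact_mod_cast this
  have hsum : ∑ s ∈ S, P.real (A s) ≤ (4 * K + 1) * ((5 * K + 1) * (1 / (512 * K))) := by
    calc ∑ s ∈ S, P.real (A s) ≤ ∑ s ∈ S, (5 * (K : ℝ) + 1) * (1 / (512 * K)) := by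
          refine Finset.sum_le_sum fun s _ => ?_
          refine (measureReal_not_hashIsolated_le hκ hκ0 (C ∪ S) s).trans ?_
          gcongr
      _ = _ := by rw [Finset.sum_const, hS, nsmul_eq_mul]; push_cast; ring
  have hmarkov := (mul_measureReal_le_card_filter_le (P := P) S A
    (fun s _ => measurableSet_preimage_hash hh fun η => ¬ HashIsolated η (C ∪ S) s)
    (K + 1)).trans hsum
  have hbound : P.real {ω | K + 1 ≤ (S.filter fun s => ω ∈ A s).card} ≤ 20 / 512 := by
    -- After clearing denominators this is `20 K² + 9 K + 1 ≤ 20 K² + 20 K`, which uses `1 ≤ K`.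
    have h1 : (4 * (K : ℝ) + 1) * ((5 * K + 1) * (1 / (512 * K))) ≤ (K + 1) * (20 / 512) := by
      rw [show (4 * (K : ℝ) + 1) * ((5 * K + 1) * (1 / (512 * K))) =
        ((4 * (K : ℝ) + 1) * (5 * K + 1)) / (512 * K) by ring, div_le_iff₀ (by positivity)]
      nlinarith
    push_cast at hmarkov
    refine le_of_mul_le_mul_left ?_ (by positivity : (0 : ℝ) < K + 1)
    convert hmarkov.trans h1
  calc P.real {ω | ¬ IsGoodForHeavy K C S u (h ω)}
      ≤ P.real ({ω | ¬ HashIsolated (h ω) C u} ∪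
          {ω | K + 1 ≤ (S.filter fun s => ω ∈ A s).card}) := by
        refine measureReal_mono fun ω hω => ?_
        rcases not_and_or.1 hω with h1 | h1
        · exact Or.inl h1
        · refine Or.inr ?_
          have h2 := Finset.card_filter_add_card_filter_not (s := S)
            (fun s => HashIsolated (h ω) (C ∪ S) s)
          show K + 1 ≤ (S.filter fun s => ¬ HashIsolated (h ω) (C ∪ S) s).card
          omega
    _ ≤ 1 / 512 + 20 / 512 := (measureReal_union_le _ _).trans
        (add_le_add (measureReal_not_hashIsolated_cover_le hK hκ hCK u) hbound)
    _ ≤ 1 / 16 := by norm_num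

end HashProbability

/-! ### The sampled graph -/

section Sampling

open scoped Classical

variable {Ω : Type*} {n m t K : ℕ} {G : SimpleGraph (Fin n)} {C : Finset (Fin n)} {δ : ℝ}
  {h : Fin t → Ω → Fin n → Fin m} {L : Fin t → Sym2 (Fin m) → Ω → Option (Sym2 (Fin n))}

/-- The output `o` of a sampler for the edge set `E` is an element of `E`, or `none` if `E` is
empty. -/
def SamplerSucceeds (E : Set (Sym2 (Fin n))) (o : Option (Sym2 (Fin n))) : Prop :=
  (∃ e ∈ E, o = some e) ∨ (E = ∅ ∧ o = none)

lemma sampledGraph_adj {ω : Ω} {u v : Fin n} :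
    (sampledGraph L ω).Adj u v ↔ (∃ i q, L i q ω = some s(u, v)) ∧ u ≠ v := by
  simp [sampledGraph]

lemma sampledGraph_le {ω : Ω}
    (hL : ∀ i q, SamplerSucceeds (hashBucket G (h i ω) q) (L i q ω)) :
    sampledGraph L ω ≤ G := by
  intro u v huv
  obtain ⟨⟨i, q, he⟩, -⟩ := sampledGraph_adj.1 huv
  rcases hL i q with ⟨e, heE, he'⟩ | ⟨-, he'⟩
  · rw [he, Option.some_inj] at he'
    subst he'
    exact (mk_mem_hashBucket.1 heE).1
  · rw [he] at he'
    exact absurd he' (by simp)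

lemma sampledGraph_adj_of_isGoodForEdge {ω : Ω} (hC : G.IsVertexCover (C : Set (Fin n)))
    (hL : ∀ i q, SamplerSucceeds (hashBucket G (h i ω) q) (L i q ω)) {u v : Fin n}
    (huv : G.Adj u v) {i : Fin t} (hi : IsGoodForEdge G C u v (h i ω)) :
    (sampledGraph L ω).Adj u v := by
  have hb := hashBucket_eq_singleton hC huv hi.1 hi.2
  refine sampledGraph_adj.2 ⟨⟨i, s(h i ω u, h i ω v), ?_⟩, huv.ne⟩
  have := hL i s(h i ω u, h i ω v)
  rw [hb] at this
  rcases this with ⟨e, rfl, he⟩ | ⟨he, -⟩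
  · exact he
  · exact absurd he (Set.singleton_ne_empty _)

/-- The bucket of `u` and an isolated `s` is nonempty and contains only edges at `u`, so its sample
is an edge `uy` with the hash value of `y` equal to that of `s`. The vertex `y` need not be `s`, but
distinct isolated `s` have distinct values and thus yield distinct `y`. -/
lemma lt_degree_sampledGraph_of_isGoodForHeavy {ω : Ω}
    (hC : G.IsVertexCover (C : Set (Fin n)))
    (hL : ∀ i q, SamplerSucceeds (hashBucket G (h i ω) q) (L i q ω)) {u : Fin n}
    {S : Finset (Fin n)} (hS : S ⊆ G.neighborFinset u \ C) {i : Fin t}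
    (hi : IsGoodForHeavy K C S u (h i ω)) : 3 * K < (sampledGraph L ω).degree u := by
  set η := h i ω with hη
  set I := S.filter fun s => HashIsolated η (C ∪ S) s with hI
  have hex : ∀ s ∈ I, ∃ y, (sampledGraph L ω).Adj u y ∧ η y = η s := by
    intro s hs
    obtain ⟨hsS, hsi⟩ := Finset.mem_filter.1 hs
    have hsN := Finset.mem_sdiff.1 (hS hsS)
    rw [SimpleGraph.mem_neighborFinset] at hsN
    rcases hL i s(η u, η s) with ⟨e, heE, he⟩ | ⟨he, -⟩
    · obtain ⟨y, hy, hys, rfl⟩ := exists_adj_of_mem_hashBucket hC hi.1 hsN.2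
        (fun x hx => hsi x (Finset.mem_union_left _ hx)) heE
      exact ⟨y, sampledGraph_adj.2 ⟨⟨i, _, he⟩, hy.ne⟩, hys⟩
    · have : s(u, s) ∈ hashBucket G η s(η u, η s) := mk_mem_hashBucket.2 ⟨hsN.1, rfl⟩
      rw [he] at this
      exact absurd this (Set.notMem_empty _)
  choose! y hy hys using hex
  have hinj : Set.InjOn y I := by
    intro a ha b hb hab
    refine injOn_hashIsolated η S (C ∪ S) Finset.subset_union_right ha hb ?_
    rw [← hys a ha, ← hys b hb, hab]
  calc 3 * K < I.card := hi.2
    _ = (I.image y).card := (Finset.card_image_of_injOn hinj).symm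
    _ ≤ ((sampledGraph L ω).neighborFinset u).card := by
        refine Finset.card_le_card fun z hz => ?_
        obtain ⟨s, hs, rfl⟩ := Finset.mem_image.1 hz
        simpa using hy s hs
    _ = _ := SimpleGraph.card_neighborFinset_eq_degree _ _

lemma pos_of_adj (hC : G.IsVertexCover (C : Set (Fin n))) (hCK : C.card ≤ K) {u v : Fin n}
    (huv : G.Adj u v) : 0 < K := by
  refine lt_of_lt_of_le (Finset.card_pos.2 ?_) hCK
  rcases hC huv with h | h
  exacts [⟨u, h⟩, ⟨v, h⟩]

lemma pos_of_lt_degree (hC : G.IsVertexCover (C : Set (Fin n))) (hCK : C.card ≤ K) {u : Fin n}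
    (hu : 5 * K < G.degree u) : 0 < K := by
  obtain ⟨v, hv⟩ := (G.degree_pos_iff_exists_adj u).1 (by omega)
  exact pos_of_adj hC hCK hv

/-- Only nonempty buckets enter the union bound over samplers, since a sampler for the empty set
fails with probability zero. Their number is bounded in terms of `n` alone, whereas `K`, and with it
the number of all buckets, is not. -/
lemma card_nonempty_hashBucket_le (G : SimpleGraph (Fin n)) (η : Fin n → Fin m) :
    (Finset.univ.filter fun q => (hashBucket G η q).Nonempty).card ≤ n ^ 2 := by
  have hsub : (Finset.univ.filter fun q => (hashBucket G η q).Nonempty) ⊆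
      (Finset.univ : Finset (Fin n × Fin n)).image fun x => s(η x.1, η x.2) := by
    intro q hq
    obtain ⟨e, he⟩ := (Finset.mem_filter.1 hq).2
    induction e using Sym2.ind with
    | _ x y =>
      rw [mk_mem_hashBucket] at he
      exact Finset.mem_image.2 ⟨(x, y), Finset.mem_univ _, he.2⟩
  calc _ ≤ _ := Finset.card_le_card hsub
    _ ≤ _ := Finset.card_image_le
    _ = n ^ 2 := by simp [sq]

/-! ### Union bounds over trials and samplers. -/

variable [MeasurableSpace Ω] {P : Measure Ω}

/-- If every trial is bad with probability at most `p`, then all trials are bad with probability at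
most `p ^ t`. -/
lemma measureReal_forall_le_pow (hind : iIndepFun h P) (p : (Fin n → Fin m) → Prop) {r : ℝ}
    (hr : ∀ i, P.real {ω | p (h i ω)} ≤ r) : P.real {ω | ∀ i, p (h i ω)} ≤ r ^ t := by
  have h1 := hind.measure_inter_preimage_eq_mul Finset.univ (sets := fun _ => {η | p η})
    (fun i _ => (Set.toFinite _).measurableSet)
  have h2 : {ω | ∀ i, p (h i ω)} = ⋂ i ∈ Finset.univ, h i ⁻¹' {η | p η} := by
    ext; simp
  rw [h2, measureReal_def, h1, ENNReal.toReal_prod]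
  calc ∏ i, (P (h i ⁻¹' {η | p η})).toReal ≤ ∏ _i : Fin t, r :=
        Finset.prod_le_prod (fun _ _ => ENNReal.toReal_nonneg) fun i _ => hr i
    _ = r ^ t := by simp

variable [IsProbabilityMeasure P]

/-- The events that a particular edge of `E` is returned are disjoint, and their lower bounds add up
to `(1 - δ) * P.real B`. -/
lemma measureReal_not_samplerSucceeds_of_nonempty {B : Set Ω} (hB : MeasurableSet B)
    {E : Set (Sym2 (Fin n))} {l : Ω → Option (Sym2 (Fin n))}
    (hl : IsL0SamplerOutput P B δ E l) (hE : E.Nonempty) :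
    P.real (B ∩ {ω | ¬ SamplerSucceeds E (l ω)}) ≤ δ * P.real B := by
  obtain ⟨hmeas, hunif, -⟩ := hl
  set A : Sym2 (Fin n) → Set Ω := fun e => B ∩ {ω | l ω = some e} with hA
  have hAm (e) : MeasurableSet (A e) := hB.inter (hmeas (some e))
  have hU : MeasurableSet (⋃ e ∈ E.toFinset, A e) :=
    Finset.measurableSet_biUnion _ fun e _ => hAm e
  have hsum : P.real (⋃ e ∈ E.toFinset, A e) = ∑ e ∈ E.toFinset, P.real (A e) := by
    refine measureReal_biUnion_finset ?_ fun e _ => hAm e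
    intro e _ e' _ hne
    refine Set.disjoint_left.2 fun ω h1 h2 => hne ?_
    have := h1.2.symm.trans h2.2
    exact Option.some_injective _ this
  have hcard : (0 : ℝ) < E.ncard := by
    exact_mod_cast (Set.ncard_pos E.toFinite).2 hE
  have hlow : (1 - δ) * P.real B ≤ P.real (⋃ e ∈ E.toFinset, A e) := by
    rw [hsum]
    calc (1 - δ) * P.real B
        = ∑ e ∈ E.toFinset, (1 - δ) / (E.ncard : ℝ) * P.real B := by
          rw [Finset.sum_const, nsmul_eq_mul, ← Set.ncard_eq_toFinset_card']
          field_simp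
      _ ≤ _ := Finset.sum_le_sum fun e he => hunif e (by simpa using he)
  have hsub : B ∩ {ω | ¬ SamplerSucceeds E (l ω)} ⊆ B \ ⋃ e ∈ E.toFinset, A e := by
    rintro ω ⟨h1, h2⟩
    refine ⟨h1, fun h3 => h2 ?_⟩
    simp only [Set.mem_iUnion] at h3
    obtain ⟨e, he, h3⟩ := h3
    exact Or.inl ⟨e, by simpa using he, h3.2⟩
  have hUB : (⋃ e ∈ E.toFinset, A e) ⊆ B := Set.iUnion₂_subset fun e _ => Set.inter_subset_left
  have := measureReal_mono (μ := P) hsub (measure_ne_top _ _)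
  rw [measureReal_sdiff hUB hU] at this
  linarith

lemma measureReal_not_samplerSucceeds_of_empty {B : Set Ω} {E : Set (Sym2 (Fin n))}
    {l : Ω → Option (Sym2 (Fin n))} (hl : IsL0SamplerOutput P B δ E l) (hE : E = ∅) :
    P.real (B ∩ {ω | ¬ SamplerSucceeds E (l ω)}) = 0 := by
  have h0 : P.real (B ∩ {ω | l ω ≠ none}) = 0 := by
    rw [measureReal_def, hl.2.2 hE, ENNReal.toReal_zero]
  refine le_antisymm ?_ measureReal_nonneg
  rw [← h0]
  refine measureReal_mono ?_ (measure_ne_top _ _)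
  rintro ω ⟨h1, h2⟩
  exact ⟨h1, fun h3 => h2 (Or.inr ⟨hE, h3⟩)⟩

/-- All samplers succeed with high probability. -/
lemma measureReal_not_forall_samplerSucceeds_le (hδ : 0 ≤ δ) (hS : IsEdgeSampling P G δ h L) :
    P.real {ω | ¬ ∀ i q, SamplerSucceeds (hashBucket G (h i ω) q) (L i q ω)} ≤
      t * (n ^ 2 * δ) := by
  -- The buckets are random, so the space is split according to the values `η` of all hash
  -- functions. On each piece the buckets are fixed and the sampler guarantee applies.
  set B : (Fin t → Fin n → Fin m) → Set Ω := fun η => {ω | ∀ j, h j ω = η j} with hB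
  have hBm (η) : MeasurableSet (B η) := by
    have : B η = ⋂ j, h j ⁻¹' {η j} := by ext; simp [hB]
    rw [this]
    exact MeasurableSet.iInter fun j => (hS.hash j).1 (measurableSet_singleton _)
  have hBsum : ∑ η, P.real (B η) = 1 := by
    have := sum_measureReal_preimage_singleton (μ := P) (f := fun ω j => h j ω)
      (Finset.univ : Finset (Fin t → Fin n → Fin m)) (fun η _ => by
        convert hBm η using 1
        ext ω
        simp [hB, funext_iff])
    rw [Finset.coe_univ, Set.preimage_univ, probReal_univ] at this
    rw [← this]
    refine Finset.sum_congr rfl fun η _ => ?_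
    congr 1
    ext ω
    simp [hB, funext_iff]
  have hone (η) (i) (q) : P.real (B η ∩ {ω | ¬ SamplerSucceeds (hashBucket G (η i) q) (L i q ω)})
      ≤ if (hashBucket G (η i) q).Nonempty then δ * P.real (B η) else 0 := by
    split_ifs with hE
    · exact measureReal_not_samplerSucceeds_of_nonempty (hBm η) (hS.sampler η i q) hE
    · exact (measureReal_not_samplerSucceeds_of_empty (hS.sampler η i q)
        (Set.not_nonempty_iff_eq_empty.1 hE)).le
  have hsub : {ω | ¬ ∀ i q, SamplerSucceeds (hashBucket G (h i ω) q) (L i q ω)} ⊆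
      ⋃ x ∈ (Finset.univ : Finset ((Fin t → Fin n → Fin m) × Fin t × Sym2 (Fin m))),
        (B x.1 ∩ {ω | ¬ SamplerSucceeds (hashBucket G (x.1 x.2.1) x.2.2) (L x.2.1 x.2.2 ω)}) := by
    intro ω hω
    simp only [Set.mem_ofPred_eq, not_forall] at hω
    obtain ⟨i, q, hω⟩ := hω
    simp only [Set.mem_iUnion]
    exact ⟨(fun j => h j ω, i, q), Finset.mem_univ _, fun j => rfl, hω⟩
  calc P.real {ω | ¬ ∀ i q, SamplerSucceeds (hashBucket G (h i ω) q) (L i q ω)}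
      ≤ _ := measureReal_mono hsub (measure_ne_top _ _)
    _ ≤ _ := measureReal_biUnion_finset_le _ _
    _ = ∑ η, ∑ i, ∑ q,
        P.real (B η ∩ {ω | ¬ SamplerSucceeds (hashBucket G (η i) q) (L i q ω)}) := by
        rw [Fintype.sum_prod_type]
        exact Finset.sum_congr rfl fun η _ => Fintype.sum_prod_type _
    _ ≤ ∑ η, ∑ i : Fin t, ∑ q,
        if (hashBucket G (η i) q).Nonempty then δ * P.real (B η) else 0 :=
        Finset.sum_le_sum fun η _ => Finset.sum_le_sum fun i _ => Finset.sum_le_sum fun q _ =>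
          hone η i q
    _ ≤ ∑ η, ∑ i : Fin t, (n : ℝ) ^ 2 * (δ * P.real (B η)) := by
        refine Finset.sum_le_sum fun η _ => Finset.sum_le_sum fun i _ => ?_
        rw [← Finset.sum_filter, Finset.sum_const, nsmul_eq_mul]
        have := card_nonempty_hashBucket_le G (η i)
        have h0 : 0 ≤ δ * P.real (B η) := mul_nonneg hδ measureReal_nonneg
        exact mul_le_mul_of_nonneg_right (by exact_mod_cast this) h0
    _ = t * (n ^ 2 * δ) * ∑ η, P.real (B η) := by
        rw [Finset.mul_sum]
        refine Finset.sum_congr rfl fun η _ => ?_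
        rw [Finset.sum_const, nsmul_eq_mul, Finset.card_univ, Fintype.card_fin]
        ring
    _ = _ := by rw [hBsum, mul_one]

/-- The sampled graph has the same small cluster deletion sets, with an explicit bound on the
failure probability. -/
lemma measureReal_sampledGraph_ge (hδ : 0 ≤ δ) (hS : IsEdgeSampling P G δ h L)
    (hm : m = 1024 * K) (hC : G.IsVertexCover (C : Set (Fin n))) (hCK : C.card ≤ K) :
    1 - (t * (n ^ 2 * δ) + (n ^ 2 * (1 / 16) ^ t + n * (1 / 16) ^ t)) ≤
      P.real {ω | ∀ X : Finset (Fin n), X.card ≤ K →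
        (IsClusterDeletionSet (sampledGraph L ω) X ↔ IsClusterDeletionSet G X)} := by
  have hκ (hK : 0 < K) (i) (a b) (hab : a ≠ b) :
      P.real {ω | h i ω a = h i ω b} ≤ 1 / (512 * K) := by
    have hK' : (0 : ℝ) < K := by exact_mod_cast hK
    refine ((hS.hash i).2 a b hab).trans ?_
    rw [hm]
    push_cast
    gcongr
    norm_num
  have hSex : ∀ u, ∃ S : Finset (Fin n), 5 * K < G.degree u →
      S ⊆ G.neighborFinset u \ C ∧ S.card = 4 * K + 1 := by
    intro u
    by_cases hu : 5 * K < G.degree u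
    · obtain ⟨S, h1, h2⟩ := exists_neighbors_outside hCK hu
      exact ⟨S, fun _ => ⟨h1, h2⟩⟩
    · exact ⟨∅, fun h => absurd h hu⟩
  choose S hSN using hSex
  set A₁ : Set Ω := {ω | ¬ ∀ i q, SamplerSucceeds (hashBucket G (h i ω) q) (L i q ω)} with hA₁
  set A₂ : Fin n × Fin n → Set Ω := fun x => {ω | G.Adj x.1 x.2 ∧ G.degree x.1 ≤ 5 * K ∧
    G.degree x.2 ≤ 5 * K ∧ ∀ i, ¬ IsGoodForEdge G C x.1 x.2 (h i ω)} with hA₂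
  set A₃ : Fin n → Set Ω := fun u => {ω | 5 * K < G.degree u ∧
    ∀ i, ¬ IsGoodForHeavy K C (S u) u (h i ω)} with hA₃
  have hA₂le (x) : P.real (A₂ x) ≤ (1 / 16) ^ t := by
    by_cases hx : G.Adj x.1 x.2 ∧ G.degree x.1 ≤ 5 * K ∧ G.degree x.2 ≤ 5 * K
    · refine (measureReal_mono (fun ω hω => hω.2.2.2) (measure_ne_top _ _)).trans
        (measureReal_forall_le_pow hS.indep (fun η => ¬ IsGoodForEdge G C x.1 x.2 η) fun i => ?_)
      have hK := pos_of_adj hC hCK hx.1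
      exact measureReal_not_isGoodForEdge_le hK (hκ hK i) hCK hx.2.1 hx.2.2
    · have : A₂ x = ∅ := by
        ext ω
        simp only [hA₂, Set.mem_ofPred_eq, Set.mem_empty_iff_false, iff_false]
        tauto
      rw [this, measureReal_empty]
      positivity
  have hA₃le (u) : P.real (A₃ u) ≤ (1 / 16) ^ t := by
    by_cases hu : 5 * K < G.degree u
    · refine (measureReal_mono (fun ω hω => hω.2) (measure_ne_top _ _)).trans
        (measureReal_forall_le_pow hS.indep (fun η => ¬ IsGoodForHeavy K C (S u) u η) fun i => ?_)
      have hK := pos_of_lt_degree hC hCK hu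
      exact measureReal_not_isGoodForHeavy_le hK (hS.hash i).1 (hκ hK i) hCK (hSN u hu).2 u
    · have : A₃ u = ∅ := by
        ext ω
        simp only [hA₃, Set.mem_ofPred_eq, Set.mem_empty_iff_false, iff_false]
        tauto
      rw [this, measureReal_empty]
      positivity
  set Bad : Set Ω := A₁ ∪ ((⋃ x ∈ Finset.univ, A₂ x) ∪ ⋃ u ∈ Finset.univ, A₃ u) with hBad
  have hBadle : P.real Bad ≤
      t * (n ^ 2 * δ) + (n ^ 2 * (1 / 16) ^ t + n * (1 / 16) ^ t) := by
    refine (measureReal_union_le _ _).trans (add_le_add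
      (measureReal_not_forall_samplerSucceeds_le hδ hS) ?_)
    refine (measureReal_union_le _ _).trans (add_le_add ?_ ?_)
    · refine (measureReal_biUnion_finset_le _ _).trans
        ((Finset.sum_le_sum fun x _ => hA₂le x).trans_eq ?_)
      simp [sq]
    · refine (measureReal_biUnion_finset_le _ _).trans
        ((Finset.sum_le_sum fun x _ => hA₃le x).trans_eq ?_)
      simp
  set Good : Set Ω := {ω | ∀ X : Finset (Fin n), X.card ≤ K →
        (IsClusterDeletionSet (sampledGraph L ω) X ↔ IsClusterDeletionSet G X)} with hGood
  have hcover : (Set.univ : Set Ω) ⊆ Bad ∪ Good := by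
    intro ω _
    by_cases hω : ω ∈ Bad
    · exact Or.inl hω
    refine Or.inr fun X hX => ?_
    simp only [hBad, Set.mem_union, Set.mem_iUnion, not_or, not_exists] at hω
    obtain ⟨h1, h2, h3⟩ := hω
    have hL : ∀ i q, SamplerSucceeds (hashBucket G (h i ω) q) (L i q ω) := by
      simpa [hA₁] using h1
    refine isClusterDeletionSet_iff_of_degree hC hCK hX (sampledGraph_le hL) ?_ ?_
    · intro u v huv hu hv
      have : ∃ i, IsGoodForEdge G C u v (h i ω) := by
        by_contra hcon
        exact h2 (u, v) (Finset.mem_univ _) ⟨huv, hu, hv, not_exists.1 hcon⟩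
      obtain ⟨i, hi⟩ := this
      exact sampledGraph_adj_of_isGoodForEdge hC hL huv hi
    · intro u hu
      have : ∃ i, IsGoodForHeavy K C (S u) u (h i ω) := by
        by_contra hcon
        exact h3 u (Finset.mem_univ _) ⟨hu, not_exists.1 hcon⟩
      obtain ⟨i, hi⟩ := this
      have := lt_degree_sampledGraph_of_isGoodForHeavy hC hL (hSN u hu).1 hi
      omega
  have h1 := (measureReal_mono (μ := P) hcover (measure_ne_top _ _)).trans
    (measureReal_union_le _ _)
  rw [probReal_univ] at h1
  linarith

/-- The three summands are at most `1/2`, `1/4` and `1/4` of the target. The exponent `2 c + 6` pays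
`c + 3` for the number of trials, `2` for the buckets, `c` for the target and `1` for the factor
`1/2`. -/
lemma sampling_error_le (c : ℕ) (hn : 2 ≤ n) :
    (((c + 2) * Nat.log 2 n : ℕ) : ℝ) * (n ^ 2 * (1 / (n : ℝ) ^ (2 * c + 6))) +
      (n ^ 2 * (1 / 16) ^ ((c + 2) * Nat.log 2 n) + n * (1 / 16) ^ ((c + 2) * Nat.log 2 n)) ≤
      1 / (n : ℝ) ^ c := by
  have hn' : (2 : ℝ) ≤ n := by exact_mod_cast hn
  have hn0 : (0 : ℝ) < n := by linarith
  have hlog1 : 1 ≤ Nat.log 2 n := Nat.log_pos (by norm_num) hn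
  have hlog : Nat.log 2 n ≤ n := Nat.log_le_self 2 n
  have hc : c + 2 ≤ n ^ (c + 2) :=
    (Nat.lt_two_pow_self).le.trans (Nat.pow_le_pow_left hn _)
  have ht : (((c + 2) * Nat.log 2 n : ℕ) : ℝ) ≤ (n : ℝ) ^ (c + 3) := by
    have : (c + 2) * Nat.log 2 n ≤ n ^ (c + 3) := by
      rw [pow_succ n (c + 2)]
      exact Nat.mul_le_mul hc hlog
    exact_mod_cast this
  have h16 : ((1 : ℝ) / 16) ^ ((c + 2) * Nat.log 2 n) ≤ 1 / (n : ℝ) ^ (2 * (c + 2)) := by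
    -- The rounding in `Nat.log` is absorbed by `2 * (log + 1) ≤ 4 * log`, valid as the logarithm is
    -- at least one.
    have h1 : n ^ 2 ≤ 16 ^ Nat.log 2 n := by
      have h2 : n < 2 ^ (Nat.log 2 n + 1) := Nat.lt_pow_succ_log_self (by norm_num) n
      calc n ^ 2 ≤ (2 ^ (Nat.log 2 n + 1)) ^ 2 := Nat.pow_le_pow_left h2.le 2
        _ = 2 ^ (2 * (Nat.log 2 n + 1)) := by rw [← pow_mul, mul_comm]
        _ ≤ 2 ^ (4 * Nat.log 2 n) := Nat.pow_le_pow_right (by norm_num) (by omega)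
        _ = 16 ^ Nat.log 2 n := by rw [pow_mul]; norm_num
    have h2 : n ^ (2 * (c + 2)) ≤ 16 ^ ((c + 2) * Nat.log 2 n) := by
      rw [pow_mul, mul_comm (c + 2), pow_mul 16]
      exact Nat.pow_le_pow_left h1 _
    rw [one_div_pow]
    exact one_div_le_one_div_of_le (by positivity) (by exact_mod_cast h2)
  have hsplit : (n : ℝ) ^ (2 * (c + 2)) = n ^ c * n ^ c * (n ^ 2 * n ^ 2) := by ring
  have hc1 : (1 : ℝ) ≤ (n : ℝ) ^ c := one_le_pow₀ (by linarith)
  have e1 : (((c + 2) * Nat.log 2 n : ℕ) : ℝ) * (n ^ 2 * (1 / (n : ℝ) ^ (2 * c + 6))) ≤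
      1 / n ^ c * (1 / 2) := by
    calc _ ≤ (n : ℝ) ^ (c + 3) * (n ^ 2 * (1 / (n : ℝ) ^ (2 * c + 6))) := by gcongr
      _ = 1 / n ^ c * (1 / n) := by
        rw [show 2 * c + 6 = (c + 3) + (c + 2 + 1) by ring, pow_add (n : ℝ) (c + 3),
          pow_add (n : ℝ) (c + 2), pow_add (n : ℝ) c 2]
        field_simp
      _ ≤ _ := by gcongr
  have e2 : (n : ℝ) ^ 2 * (1 / 16) ^ ((c + 2) * Nat.log 2 n) ≤ 1 / n ^ c * (1 / 4) := by
    calc _ ≤ (n : ℝ) ^ 2 * (1 / (n : ℝ) ^ (2 * (c + 2))) := by gcongr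
      _ = 1 / n ^ c * (1 / (n ^ c * n ^ 2)) := by rw [hsplit]; field_simp
      _ ≤ _ := by
        have : (4 : ℝ) ≤ n ^ c * n ^ 2 := by nlinarith [sq_nonneg (n : ℝ)]
        gcongr
  have e3 : (n : ℝ) * (1 / 16) ^ ((c + 2) * Nat.log 2 n) ≤ 1 / n ^ c * (1 / 4) := by
    refine le_trans ?_ e2
    gcongr
    nlinarith
  linarith

theorem exists_sampling_parameters (c : ℕ) : ∃ α β c' : ℕ, 0 < α ∧ 0 < β ∧
    ∀ (n K : ℕ) (G : SimpleGraph (Fin n)), G.vertexCoverNum ≤ K →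
    ∀ (Ω : Type) [MeasurableSpace Ω] (P : Measure Ω) [IsProbabilityMeasure P]
      (h : Fin (α * Nat.log 2 n) → Ω → Fin n → Fin (β * K))
      (L : Fin (α * Nat.log 2 n) → Sym2 (Fin (β * K)) → Ω → Option (Sym2 (Fin n))),
      IsEdgeSampling P G (1 / (n : ℝ) ^ c') h L →
      1 - 1 / (n : ℝ) ^ c ≤
        P.real {ω | ∀ X : Finset (Fin n), X.card ≤ K →
          (IsClusterDeletionSet (sampledGraph L ω) X ↔ IsClusterDeletionSet G X)} := by
  refine ⟨c + 2, 1024, 2 * c + 6, by omega, by norm_num, ?_⟩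
  intro n K G hG Ω _ P _ h L hS
  obtain ⟨C, hC, hCK⟩ := exists_finset_isVertexCover hG
  rcases Nat.lt_or_ge n 2 with hn | hn
  -- There are no trials here, but there is also only one graph on at most one vertex.
  · have : Subsingleton (Fin n) := Fin.subsingleton_iff_le_one.2 (by omega)
    have hall : {ω | ∀ X : Finset (Fin n), X.card ≤ K →
        (IsClusterDeletionSet (sampledGraph L ω) X ↔ IsClusterDeletionSet G X)} = Set.univ := by
      ext ω
      simp [Subsingleton.elim (sampledGraph L ω) G]
    rw [hall, probReal_univ]
    have : (0 : ℝ) ≤ 1 / (n : ℝ) ^ c := by positivity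
    linarith
  · refine le_trans ?_ (measureReal_sampledGraph_ge (by positivity) hS rfl hC hCK)
    exact sub_le_sub_left (sampling_error_le c hn) 1

end Sampling

/-! ### Closure properties of primitive recursive functions -/

section Primrec

variable {α : Type*} [Primcodable α]

lemma Primrec.nat_add' {f g : α → ℕ} (hf : Primrec f) (hg : Primrec g) :
    Primrec fun a => f a + g a := Primrec.nat_add.comp hf hg

lemma Primrec.nat_sub' {f g : α → ℕ} (hf : Primrec f) (hg : Primrec g) :
    Primrec fun a => f a - g a := Primrec.nat_sub.comp hf hg

lemma Primrec.nat_mul' {f g : α → ℕ} (hf : Primrec f) (hg : Primrec g) :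
    Primrec fun a => f a * g a := Primrec.nat_mul.comp hf hg

lemma Primrec.nat_div' {f g : α → ℕ} (hf : Primrec f) (hg : Primrec g) :
    Primrec fun a => f a / g a := Primrec.nat_div.comp hf hg

lemma Primrec.nat_mod' {f g : α → ℕ} (hf : Primrec f) (hg : Primrec g) :
    Primrec fun a => f a % g a := Primrec.nat_mod.comp hf hg

lemma Primrec.nat_min' {f g : α → ℕ} (hf : Primrec f) (hg : Primrec g) :
    Primrec fun a => min (f a) (g a) := Primrec.nat_min.comp hf hg

lemma Primrec.nat_max' {f g : α → ℕ} (hf : Primrec f) (hg : Primrec g) :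
    Primrec fun a => max (f a) (g a) := Primrec.nat_max.comp hf hg

lemma Primrec.nat_pow' {f g : α → ℕ} (hf : Primrec f) (hg : Primrec g) :
    Primrec fun a => f a ^ g a :=
  (Primrec₂.unpaired'.1 Nat.Primrec.pow).comp hf hg

lemma Primrec.natPair' {f g : α → ℕ} (hf : Primrec f) (hg : Primrec g) :
    Primrec fun a => Nat.pair (f a) (g a) := Primrec₂.natPair.comp hf hg

lemma Primrec.natUnpairFst {f : α → ℕ} (hf : Primrec f) : Primrec fun a => (f a).unpair.1 :=
  Primrec.fst.comp (Primrec.unpair.comp hf)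

lemma Primrec.natUnpairSnd {f : α → ℕ} (hf : Primrec f) : Primrec fun a => (f a).unpair.2 :=
  Primrec.snd.comp (Primrec.unpair.comp hf)

lemma PrimrecPred.eq' {f g : α → ℕ} (hf : Primrec f) (hg : Primrec g) :
    PrimrecPred fun a => f a = g a := Primrec.eq.comp hf hg

lemma PrimrecPred.lt' {f g : α → ℕ} (hf : Primrec f) (hg : Primrec g) :
    PrimrecPred fun a => f a < g a := Primrec.nat_lt.comp hf hg

lemma PrimrecPred.le' {f g : α → ℕ} (hf : Primrec f) (hg : Primrec g) :
    PrimrecPred fun a => f a ≤ g a := Primrec.nat_le.comp hf hg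

lemma PrimrecPred.imp' {p q : α → Prop} (hp : PrimrecPred p) (hq : PrimrecPred q) :
    PrimrecPred fun a => p a → q a :=
  (hp.not.or hq).of_eq fun _ => imp_iff_not_or.symm

lemma PrimrecPred.forall_lt' {g : α → ℕ} {R : α → ℕ → Prop} (hg : Primrec g)
    (hR : PrimrecPred fun x : α × ℕ => R x.1 x.2) : PrimrecPred fun a => ∀ x < g a, R a x := by
  have h : PrimrecRel fun (x : ℕ) (a : α) => R a x :=
    hR.comp (Primrec.pair Primrec.snd Primrec.fst)
  exact (h.forall_mem_list.comp (Primrec.list_range.comp hg) Primrec.id).of_eq fun a => by simp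

lemma PrimrecPred.exists_lt' {g : α → ℕ} {R : α → ℕ → Prop} (hg : Primrec g)
    (hR : PrimrecPred fun x : α × ℕ => R x.1 x.2) : PrimrecPred fun a => ∃ x < g a, R a x := by
  have h : PrimrecRel fun (x : ℕ) (a : α) => R a x :=
    hR.comp (Primrec.pair Primrec.snd Primrec.fst)
  exact (h.exists_mem_list.comp (Primrec.list_range.comp hg) Primrec.id).of_eq fun a => by simp

lemma Primrec.sum_range {g : α → ℕ} {f : α → ℕ → ℕ} (hg : Primrec g)
    (hf : Primrec fun x : α × ℕ => f x.1 x.2) :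
    Primrec fun a => ∑ i ∈ Finset.range (g a), f a i := by
  have h := Primrec.nat_rec' (f := g) (g := fun _ => (0 : ℕ))
    (h := fun a (p : ℕ × ℕ) => p.2 + f a p.1) hg (Primrec.const 0)
    (Primrec.nat_add' (Primrec.snd.comp Primrec.snd)
      (hf.comp (Primrec.pair Primrec.fst (Primrec.fst.comp Primrec.snd))))
  refine h.of_eq fun a => ?_
  induction g a with
  | zero => rfl
  | succ k ih => rw [Finset.sum_range_succ, ← ih]

lemma Primrec.card_filter_range {g : α → ℕ} {R : α → ℕ → Prop} [∀ a, DecidablePred (R a)]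
    (hg : Primrec g)
    (hR : PrimrecPred fun x : α × ℕ => R x.1 x.2) :
    Primrec fun a => ((Finset.range (g a)).filter (R a)).card := by
  have h := Primrec.sum_range (f := fun a i => if R a i then 1 else 0) hg
    (Primrec.ite (c := fun x : α × ℕ => R x.1 x.2) hR (Primrec.const 1) (Primrec.const 0))
  exact h.of_eq fun a => (Finset.card_filter _ _).symm

lemma Primrec.filter_range {g : α → ℕ} {R : α → ℕ → Prop} [∀ a, DecidablePred (R a)]
    (hg : Primrec g)
    (hR : PrimrecPred fun x : α × ℕ => R x.1 x.2) :
    Primrec fun a => (List.range (g a)).filter (R a ·) := by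
  have h : PrimrecRel fun (x : ℕ) (a : α) => R a x :=
    hR.comp (Primrec.pair Primrec.snd Primrec.fst)
  let _ : DecidableRel fun (x : ℕ) (a : α) => R a x := fun x a => inferInstance
  exact h.listFilter.comp (Primrec.list_range.comp hg) Primrec.id

lemma Primrec.nat_log_two : Primrec (Nat.log 2) := by
  have h := Primrec.nat_findGreatest (f := fun n : ℕ => n) (p := fun n k => 2 ^ k ≤ n)
    Primrec.id (PrimrecPred.le' (Primrec.nat_pow' (Primrec.const 2) Primrec.snd) Primrec.fst)
  refine h.of_eq fun n => ?_
  rw [Nat.findGreatest_eq_iff]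
  refine ⟨Nat.log_le_self 2 n, fun hn => Nat.pow_log_le_self 2 ?_, fun k hk _ => ?_⟩
  · rintro rfl
    simp at hn
  · rw [not_le]
    exact Nat.lt_pow_of_log_lt (by norm_num) hk

lemma PrimrecPred.nat_prime : PrimrecPred Nat.Prime := by
  have h : PrimrecPred fun p : ℕ => 2 ≤ p ∧ ∀ m < p, m < 2 ∨ ¬ (p % m = 0) :=
    (PrimrecPred.le' (Primrec.const 2) Primrec.id).and
      (PrimrecPred.forall_lt' Primrec.id
        ((PrimrecPred.lt' Primrec.snd (Primrec.const 2)).or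
          (PrimrecPred.eq' (Primrec.nat_mod' Primrec.fst Primrec.snd) (Primrec.const 0)).not))
  refine h.of_eq fun p => ?_
  rw [Nat.prime_def_lt']
  refine and_congr_right fun _ => forall_congr' fun m => ?_
  rw [Nat.dvd_iff_mod_eq_zero]
  constructor
  · intro h1 h2 h3
    rcases h1 h3 with h | h
    · omega
    · exact h
  · intro h1 h2
    by_cases hm : m < 2
    · exact Or.inl hm
    · exact Or.inr (h1 (by omega) h2)

end Primrec

/-! ### The sketch -/

/-- The number of bits of a vertex. -/
def vertexBits (n : ℕ) : ℕ := Nat.log 2 n + 1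

/-- The number of hash functions. -/
def trialCount (n K : ℕ) : ℕ := if K = 0 then 0 else 5 * vertexBits n

/-- A prime greater than `n` and at most `2 n` (for positive `n`). -/
def hashPrime (n : ℕ) : ℕ := Nat.findGreatest Nat.Prime (max 2 (2 * n))

/-- The hash value of `v` for the multiplier `a + 1`. -/
def multHash (n K a v : ℕ) : ℕ := ((a + 1) * v % hashPrime n) % (1024 * K)

/-- The `i`-th multiplier encoded in the seed `ω`. -/
def seedDigit (n ω i : ℕ) : ℕ := ω / (hashPrime n - 1) ^ i % (hashPrime n - 1)

/-- The `i`-th hash function for the seed `ω`. -/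
def trialHash (n K ω i v : ℕ) : ℕ := multHash n K (seedDigit n ω i) v

/-- The index of the counter for the `i`-th hash function and the hash values `r` and `s`. -/
def counterIndex (K i r s : ℕ) : ℕ := (i * (1024 * K) + min r s) * (1024 * K) + max r s

/-- The number by which an edge is represented in a counter. The code of one edge is less than the
sum of the codes of two edges. -/
def edgeCode (n u v : ℕ) : ℕ := n ^ 2 + (min u v * n + max u v)

/-- The counters are the digits of the sketch in this base. -/
def counterBase (n : ℕ) : ℕ := 2 ^ (5 * vertexBits n)

/-- The contribution of an edge to the sketch. -/
def edgeWeight (n K ω u v : ℕ) : ℕ :=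
  ∑ i ∈ Finset.range (trialCount n K), edgeCode n u v *
    counterBase n ^ counterIndex K i (trialHash n K ω i u) (trialHash n K ω i v)

/-- The value of the `j`-th counter of the sketch `σ`. -/
def counter (n σ j : ℕ) : ℕ := σ / counterBase n ^ j % counterBase n

/-- The pair `uv` is the only edge in its bucket for one of the hash functions. -/
def IsRecovered (n K ω σ u v : ℕ) : Prop :=
  ∃ i < trialCount n K,
    counter n σ (counterIndex K i (trialHash n K ω i u) (trialHash n K ω i v)) = edgeCode n u v

open scoped Classical in
/-- The number of occupied buckets in the row of `v` for the `i`-th hash function. -/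
noncomputable def rowCount (n K ω σ i v : ℕ) : ℕ :=
  ((Finset.range (1024 * K)).filter fun r =>
    counter n σ (counterIndex K i (trialHash n K ω i v) r) ≠ 0).card

open scoped Classical in
/-- For most of the hash functions the row of `v` has many occupied buckets. -/
def IsDeclaredHeavy (n K ω σ v : ℕ) : Prop :=
  trialCount n K <
    2 * ((Finset.range (trialCount n K)).filter fun i => 3 * K < rowCount n K ω σ i v).card

/-- `v` belongs to the set of vertices that is encoded by the bits of `x`. -/
def InMask (x v : ℕ) : Prop := x / 2 ^ v % 2 = 1

open scoped Classical in
/-- The list of the vertices in the set encoded by `x`. -/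
noncomputable def maskList (n x : ℕ) : List ℕ := (List.range n).filter (InMask x ·)

/-- According to the sketch, `x` encodes a cluster deletion set of size at most `k`. -/
def IsMaskSolution (n K k ω σ x : ℕ) : Prop :=
  (maskList n x).length ≤ k ∧ (∀ v < n, IsDeclaredHeavy n K ω σ v → InMask x v) ∧
    ∀ u < n, ∀ v < n, ∀ w < n, ¬ InMask x u → ¬ InMask x v → ¬ InMask x w →
      IsRecovered n K ω σ u v → IsRecovered n K ω σ v w → ¬ u = w → IsRecovered n K ω σ u w

open scoped Classical in
/-- The answer computed from the seed and the sketch. -/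
noncomputable def sketchAnswer (n K k ω σ : ℕ) : Option (List ℕ) :=
  (((List.range (2 ^ n)).filter (IsMaskSolution n K k ω σ ·)).head?).map (maskList n)

/-! ### The sketch and its evaluation are primitive recursive. -/

section PrimrecSketch

variable {α : Type*} [Primcodable α] {n K k ω σ i u v x r s a j : α → ℕ}

lemma primrec_vertexBits (hn : Primrec n) : Primrec fun a => vertexBits (n a) :=
  (Primrec.nat_log_two.comp hn).nat_add' (Primrec.const 1)

lemma primrec_trialCount (hn : Primrec n) (hK : Primrec K) :
    Primrec fun a => trialCount (n a) (K a) :=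
  Primrec.ite (PrimrecPred.eq' hK (Primrec.const 0)) (Primrec.const 0)
    ((Primrec.const 5).nat_mul' (primrec_vertexBits hn))

lemma primrec_hashPrime (hn : Primrec n) : Primrec fun a => hashPrime (n a) :=
  Primrec.nat_findGreatest (p := fun _ k => Nat.Prime k)
    ((Primrec.const 2).nat_max' ((Primrec.const 2).nat_mul' hn))
    (PrimrecPred.nat_prime.comp Primrec.snd)

lemma primrec_trialHash (hn : Primrec n) (hK : Primrec K) (hω : Primrec ω) (hi : Primrec i)
    (hv : Primrec v) : Primrec fun a => trialHash (n a) (K a) (ω a) (i a) (v a) := by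
  have hp := primrec_hashPrime hn
  have hp1 := hp.nat_sub' (Primrec.const 1)
  have hd := (hω.nat_div' (hp1.nat_pow' hi)).nat_mod' hp1
  exact (((hd.nat_add' (Primrec.const 1)).nat_mul' hv).nat_mod' hp).nat_mod'
    ((Primrec.const 1024).nat_mul' hK)

lemma primrec_counterIndex (hK : Primrec K) (hi : Primrec i) (hr : Primrec r) (hs : Primrec s) :
    Primrec fun a => counterIndex (K a) (i a) (r a) (s a) := by
  have hm := (Primrec.const 1024).nat_mul' hK
  exact (((hi.nat_mul' hm).nat_add' (hr.nat_min' hs)).nat_mul' hm).nat_add' (hr.nat_max' hs)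

lemma primrec_edgeCode (hn : Primrec n) (hu : Primrec u) (hv : Primrec v) :
    Primrec fun a => edgeCode (n a) (u a) (v a) :=
  (hn.nat_pow' (Primrec.const 2)).nat_add'
    (((hu.nat_min' hv).nat_mul' hn).nat_add' (hu.nat_max' hv))

lemma primrec_counterBase (hn : Primrec n) : Primrec fun a => counterBase (n a) :=
  (Primrec.const 2).nat_pow' ((Primrec.const 5).nat_mul' (primrec_vertexBits hn))

lemma primrec_edgeWeight (hn : Primrec n) (hK : Primrec K) (hω : Primrec ω) (hu : Primrec u)
    (hv : Primrec v) : Primrec fun a => edgeWeight (n a) (K a) (ω a) (u a) (v a) := by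
  have hn' := hn.comp (Primrec.fst (α := α) (β := ℕ))
  have hK' := hK.comp (Primrec.fst (α := α) (β := ℕ))
  have hω' := hω.comp (Primrec.fst (α := α) (β := ℕ))
  have hu' := hu.comp (Primrec.fst (α := α) (β := ℕ))
  have hv' := hv.comp (Primrec.fst (α := α) (β := ℕ))
  exact Primrec.sum_range (primrec_trialCount hn hK)
    ((primrec_edgeCode hn' hu' hv').nat_mul' ((primrec_counterBase hn').nat_pow'
      (primrec_counterIndex hK' Primrec.snd (primrec_trialHash hn' hK' hω' Primrec.snd hu')
        (primrec_trialHash hn' hK' hω' Primrec.snd hv'))))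

lemma primrec_counter (hn : Primrec n) (hσ : Primrec σ) (hj : Primrec j) :
    Primrec fun a => counter (n a) (σ a) (j a) :=
  (hσ.nat_div' ((primrec_counterBase hn).nat_pow' hj)).nat_mod' (primrec_counterBase hn)

lemma primrecPred_isRecovered (hn : Primrec n) (hK : Primrec K) (hω : Primrec ω) (hσ : Primrec σ)
    (hu : Primrec u) (hv : Primrec v) :
    PrimrecPred fun a => IsRecovered (n a) (K a) (ω a) (σ a) (u a) (v a) := by
  have hn' := hn.comp (Primrec.fst (α := α) (β := ℕ))
  have hK' := hK.comp (Primrec.fst (α := α) (β := ℕ))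
  have hω' := hω.comp (Primrec.fst (α := α) (β := ℕ))
  have hσ' := hσ.comp (Primrec.fst (α := α) (β := ℕ))
  have hu' := hu.comp (Primrec.fst (α := α) (β := ℕ))
  have hv' := hv.comp (Primrec.fst (α := α) (β := ℕ))
  exact PrimrecPred.exists_lt' (primrec_trialCount hn hK)
    (PrimrecPred.eq' (primrec_counter hn' hσ' (primrec_counterIndex hK' Primrec.snd
      (primrec_trialHash hn' hK' hω' Primrec.snd hu')
      (primrec_trialHash hn' hK' hω' Primrec.snd hv'))) (primrec_edgeCode hn' hu' hv'))

lemma primrec_rowCount (hn : Primrec n) (hK : Primrec K) (hω : Primrec ω) (hσ : Primrec σ)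
    (hi : Primrec i) (hv : Primrec v) :
    Primrec fun a => rowCount (n a) (K a) (ω a) (σ a) (i a) (v a) := by
  have hn' := hn.comp (Primrec.fst (α := α) (β := ℕ))
  have hK' := hK.comp (Primrec.fst (α := α) (β := ℕ))
  have hω' := hω.comp (Primrec.fst (α := α) (β := ℕ))
  have hσ' := hσ.comp (Primrec.fst (α := α) (β := ℕ))
  have hi' := hi.comp (Primrec.fst (α := α) (β := ℕ))
  have hv' := hv.comp (Primrec.fst (α := α) (β := ℕ))
  exact Primrec.card_filter_range (R := fun a r => counter (n a) (σ a)
      (counterIndex (K a) (i a) (trialHash (n a) (K a) (ω a) (i a) (v a)) r) ≠ 0)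
    ((Primrec.const 1024).nat_mul' hK)
    (PrimrecPred.eq' (primrec_counter hn' hσ' (primrec_counterIndex hK' hi'
      (primrec_trialHash hn' hK' hω' hi' hv') Primrec.snd)) (Primrec.const 0)).not

lemma primrecPred_isDeclaredHeavy (hn : Primrec n) (hK : Primrec K) (hω : Primrec ω)
    (hσ : Primrec σ) (hv : Primrec v) :
    PrimrecPred fun a => IsDeclaredHeavy (n a) (K a) (ω a) (σ a) (v a) := by
  have hn' := hn.comp (Primrec.fst (α := α) (β := ℕ))
  have hK' := hK.comp (Primrec.fst (α := α) (β := ℕ))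
  have hω' := hω.comp (Primrec.fst (α := α) (β := ℕ))
  have hσ' := hσ.comp (Primrec.fst (α := α) (β := ℕ))
  have hv' := hv.comp (Primrec.fst (α := α) (β := ℕ))
  exact PrimrecPred.lt' (primrec_trialCount hn hK) ((Primrec.const 2).nat_mul'
    (Primrec.card_filter_range (R := fun a i => 3 * K a < rowCount (n a) (K a) (ω a) (σ a) i (v a))
      (primrec_trialCount hn hK)
      (PrimrecPred.lt' ((Primrec.const 3).nat_mul' hK')
        (primrec_rowCount hn' hK' hω' hσ' Primrec.snd hv'))))

lemma primrecPred_inMask (hx : Primrec x) (hv : Primrec v) :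
    PrimrecPred fun a => InMask (x a) (v a) :=
  PrimrecPred.eq' ((hx.nat_div' ((Primrec.const 2).nat_pow' hv)).nat_mod' (Primrec.const 2))
    (Primrec.const 1)

open scoped Classical in
lemma primrec_maskList (hn : Primrec n) (hx : Primrec x) :
    Primrec fun a => maskList (n a) (x a) :=
  Primrec.filter_range (R := fun a v => InMask (x a) v) hn
    (primrecPred_inMask (hx.comp Primrec.fst) Primrec.snd)

lemma primrecPred_isMaskSolution (hn : Primrec n) (hK : Primrec K) (hk : Primrec k)
    (hω : Primrec ω) (hσ : Primrec σ) (hx : Primrec x) :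
    PrimrecPred fun a => IsMaskSolution (n a) (K a) (k a) (ω a) (σ a) (x a) := by
  refine (PrimrecPred.le' (Primrec.list_length.comp (primrec_maskList hn hx)) hk).and
    ((PrimrecPred.forall_lt' hn ?_).and
      (PrimrecPred.forall_lt' hn (PrimrecPred.forall_lt' (hn.comp Primrec.fst)
        (PrimrecPred.forall_lt' ((hn.comp Primrec.fst).comp Primrec.fst) ?_))))
  · have π := Primrec.fst (α := α) (β := ℕ)
    exact (primrecPred_isDeclaredHeavy (hn.comp π) (hK.comp π) (hω.comp π) (hσ.comp π)
      Primrec.snd).imp' (primrecPred_inMask (hx.comp π) Primrec.snd)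
  · have π : Primrec fun y : ((α × ℕ) × ℕ) × ℕ => y.1.1.1 :=
      Primrec.fst.comp (Primrec.fst.comp Primrec.fst)
    have hu : Primrec fun y : ((α × ℕ) × ℕ) × ℕ => y.1.1.2 :=
      Primrec.snd.comp (Primrec.fst.comp Primrec.fst)
    have hv : Primrec fun y : ((α × ℕ) × ℕ) × ℕ => y.1.2 := Primrec.snd.comp Primrec.fst
    have hw : Primrec fun y : ((α × ℕ) × ℕ) × ℕ => y.2 := Primrec.snd
    have hn' := hn.comp π
    have hK' := hK.comp π
    have hω' := hω.comp π
    have hσ' := hσ.comp π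
    have hx' := hx.comp π
    exact (primrecPred_inMask hx' hu).not.imp' ((primrecPred_inMask hx' hv).not.imp'
      ((primrecPred_inMask hx' hw).not.imp'
        ((primrecPred_isRecovered hn' hK' hω' hσ' hu hv).imp'
          ((primrecPred_isRecovered hn' hK' hω' hσ' hv hw).imp'
            ((PrimrecPred.eq' hu hw).not.imp'
              (primrecPred_isRecovered hn' hK' hω' hσ' hu hw))))))

open scoped Classical in
lemma primrec_sketchAnswer (hn : Primrec n) (hK : Primrec K) (hk : Primrec k)
    (hω : Primrec ω) (hσ : Primrec σ) :
    Primrec fun a => sketchAnswer (n a) (K a) (k a) (ω a) (σ a) := by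
  have π := Primrec.fst (α := α) (β := ℕ)
  refine Primrec.option_map (Primrec.list_head?.comp
    (Primrec.filter_range (R := fun a x => IsMaskSolution (n a) (K a) (k a) (ω a) (σ a) x)
      ((Primrec.const 2).nat_pow' hn) (primrecPred_isMaskSolution (hn.comp π) (hK.comp π)
        (hk.comp π) (hω.comp π) (hσ.comp π) Primrec.snd)))
    (g := fun a x => maskList (n a) x) (primrec_maskList (hn.comp π) Primrec.snd)

end PrimrecSketch

/-- The streaming algorithm for Cluster Vertex Deletion: the memory contains the seed and the
sketch of the current graph. -/
noncomputable def sketchAlgorithm : StreamingAlgorithm where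
  seedCount p := (hashPrime p.1 - 1) ^ trialCount p.1 p.2.1
  start _ ω := Nat.pair ω 0
  update p μ e := if e.2.2 = true
    then Nat.pair μ.unpair.1 (μ.unpair.2 + edgeWeight p.1 p.2.1 μ.unpair.1 e.1 e.2.1)
    else Nat.pair μ.unpair.1 (μ.unpair.2 - edgeWeight p.1 p.2.1 μ.unpair.1 e.1 e.2.1)
  output p μ := sketchAnswer p.1 p.2.1 p.2.2 μ.unpair.1 μ.unpair.2
  seedCount_pos p := by
    refine pow_pos (Nat.sub_pos_of_lt ?_) _
    have : Nat.Prime (hashPrime p.1) :=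
      Nat.findGreatest_spec (m := 2) (le_max_left _ _) Nat.prime_two
    exact this.one_lt
  computable_seedCount := by
    have hn : Primrec fun p : StreamParams => p.1 := Primrec.fst
    have hK : Primrec fun p : StreamParams => p.2.1 := Primrec.fst.comp Primrec.snd
    exact (((primrec_hashPrime hn).nat_sub' (Primrec.const 1)).nat_pow'
      (primrec_trialCount hn hK)).to_comp
  computable_start := (Primrec.natPair' Primrec.snd (Primrec.const 0)).to_comp
  computable_update := by
    have hn : Primrec fun x : StreamParams × ℕ × StreamToken => x.1.1 :=
      Primrec.fst.comp Primrec.fst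
    have hK : Primrec fun x : StreamParams × ℕ × StreamToken => x.1.2.1 :=
      Primrec.fst.comp (Primrec.snd.comp Primrec.fst)
    have hμ : Primrec fun x : StreamParams × ℕ × StreamToken => x.2.1 :=
      Primrec.fst.comp Primrec.snd
    have he : Primrec fun x : StreamParams × ℕ × StreamToken => x.2.2 :=
      Primrec.snd.comp Primrec.snd
    have hw := primrec_edgeWeight hn hK hμ.natUnpairFst (Primrec.fst.comp he)
      (Primrec.fst.comp (Primrec.snd.comp he))
    exact (Primrec.ite (Primrec.eq.comp (Primrec.snd.comp (Primrec.snd.comp he))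
      (Primrec.const true)) (hμ.natUnpairFst.natPair' (hμ.natUnpairSnd.nat_add' hw))
      (hμ.natUnpairFst.natPair' (hμ.natUnpairSnd.nat_sub' hw))).to_comp
  computable_output := by
    have hn : Primrec fun x : StreamParams × ℕ => x.1.1 := Primrec.fst.comp Primrec.fst
    have hK : Primrec fun x : StreamParams × ℕ => x.1.2.1 :=
      Primrec.fst.comp (Primrec.snd.comp Primrec.fst)
    have hk : Primrec fun x : StreamParams × ℕ => x.1.2.2 :=
      Primrec.snd.comp (Primrec.snd.comp Primrec.fst)
    have hμ : Primrec fun x : StreamParams × ℕ => x.2 := Primrec.snd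
    exact (primrec_sketchAnswer hn hK hk hμ.natUnpairFst hμ.natUnpairSnd).to_comp

/-! ### Multiplicative hashing -/

lemma prime_hashPrime (n : ℕ) : (hashPrime n).Prime :=
  Nat.findGreatest_spec (m := 2) (le_max_left _ _) Nat.prime_two

lemma lt_hashPrime (n : ℕ) : n < hashPrime n := by
  rcases Nat.eq_zero_or_pos n with rfl | hn
  · exact (prime_hashPrime 0).pos
  · obtain ⟨p, hp, hnp, hp2⟩ := Nat.exists_prime_lt_and_le_two_mul n hn.ne'
    exact hnp.trans_le (Nat.le_findGreatest (hp2.trans (le_max_right _ _)) hp)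

lemma hashPrime_le (n : ℕ) : hashPrime n ≤ max 2 (2 * n) := Nat.findGreatest_le _

/-- Two distinct residues collide for few of the multipliers. -/
lemma card_collision_le {p m x y : ℕ} (hp : p.Prime) (hm : 0 < m) (hx : x < p) (hy : y < p)
    (hxy : x ≠ y) :
    (Finset.univ.filter fun a : Fin (p - 1) =>
      ((a : ℕ) + 1) * x % p % m = ((a : ℕ) + 1) * y % p % m).card ≤ 2 * ((p - 1) / m) := by
  have hpZ : Prime (p : ℤ) := Nat.prime_iff_prime_int.1 hp
  have hmZ : (0 : ℤ) < m := by exact_mod_cast hm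
  -- Modulo `p`, `d a` is `(a + 1) * (x - y)`, so `d` is injective and never zero, with values in
  -- `[-(p - 1), p - 1]`. A collision means that `m` divides `d a`, and that interval has `2 * ((p -
  -- 1) / m)` nonzero multiples of `m`.
  set d : Fin (p - 1) → ℤ := fun a =>
    ((((a : ℕ) + 1) * x % p : ℕ) : ℤ) - ((((a : ℕ) + 1) * y % p : ℕ) : ℤ) with hd
  have hdmod (a : Fin (p - 1)) : (p : ℤ) ∣ ((a : ℤ) + 1) * ((x : ℤ) - y) - d a := by
    have h1 : ((p * (((a : ℕ) + 1) * x / p) + ((a : ℕ) + 1) * x % p : ℕ) : ℤ) =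
      ((((a : ℕ) + 1) * x : ℕ) : ℤ) := by rw [Nat.div_add_mod]
    have h2 : ((p * (((a : ℕ) + 1) * y / p) + ((a : ℕ) + 1) * y % p : ℕ) : ℤ) =
      ((((a : ℕ) + 1) * y : ℕ) : ℤ) := by rw [Nat.div_add_mod]
    rw [Nat.cast_add, Nat.cast_mul, Nat.cast_mul _ x, Nat.cast_succ] at h1
    rw [Nat.cast_add, Nat.cast_mul, Nat.cast_mul _ y, Nat.cast_succ] at h2
    exact ⟨((((a : ℕ) + 1) * x / p : ℕ) : ℤ) - ((((a : ℕ) + 1) * y / p : ℕ) : ℤ), by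
      simp only [hd]; linear_combination h2 - h1⟩
  have hxy' : ¬ (p : ℤ) ∣ (x : ℤ) - y := by
    intro h
    have := Int.eq_zero_of_abs_lt_dvd h (by rw [abs_lt]; omega)
    omega
  have habs (a : Fin (p - 1)) : -((p - 1 : ℕ) : ℤ) ≤ d a ∧ d a ≤ ((p - 1 : ℕ) : ℤ) := by
    have h1 := Nat.mod_lt (((a : ℕ) + 1) * x) hp.pos
    have h2 := Nat.mod_lt (((a : ℕ) + 1) * y) hp.pos
    simp only [hd]
    omega
  have hdvd {a : Fin (p - 1)} (ha : ((a : ℕ) + 1) * x % p % m = ((a : ℕ) + 1) * y % p % m) :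
      (m : ℤ) ∣ d a := Nat.modEq_iff_dvd.1 (Eq.symm ha)
  have hd0 (a : Fin (p - 1)) : d a ≠ 0 := by
    intro h0
    have h1 := hdmod a
    rw [h0, sub_zero] at h1
    rcases hpZ.dvd_or_dvd h1 with h | h
    · have := Int.le_of_dvd (by positivity) h
      have := a.2
      omega
    · exact hxy' h
  have hinj : Function.Injective d := by
    intro a b hab
    have h1 := dvd_sub (hdmod a) (hdmod b)
    rw [hab, show ((a : ℤ) + 1) * ((x : ℤ) - y) - d b - (((b : ℤ) + 1) * ((x : ℤ) - y) - d b) =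
      ((a : ℤ) - b) * ((x : ℤ) - y) by ring] at h1
    rcases hpZ.dvd_or_dvd h1 with h | h
    · have ha := a.2
      have hb := b.2
      have := Int.eq_zero_of_abs_lt_dvd h (by rw [abs_lt]; omega)
      exact Fin.ext (by omega)
    · exact absurd h hxy'
  have hcard (q : ℕ) : ((Finset.Icc (-(q : ℤ)) (q : ℤ)).erase 0).card = 2 * q := by
    rw [Finset.card_erase_of_mem (Finset.mem_Icc.2 ⟨by omega, by omega⟩), Int.card_Icc]
    omega
  rw [← hcard]
  refine Finset.card_le_card_of_injOn (fun a => d a / m) ?_ ?_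
  · intro a ha
    obtain ⟨c, hc⟩ := hdvd (Finset.mem_filter.1 ha).2
    have hc' : d a / m = c := by rw [hc, Int.mul_ediv_cancel_left _ hmZ.ne']
    have h1 := habs a
    simp only [Finset.coe_erase, Finset.coe_Icc, Set.mem_sdiff, Set.mem_Icc,
      Set.mem_singleton_iff]
    rw [hc', Int.natCast_div]
    refine ⟨⟨?_, ?_⟩, ?_⟩
    · rw [neg_le, Int.le_ediv_iff_mul_le hmZ]
      nlinarith
    · rw [Int.le_ediv_iff_mul_le hmZ]
      nlinarith
    · rintro rfl
      exact hd0 a (by rw [hc, mul_zero])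
  · intro a ha b hb hab
    refine hinj ?_
    have h1 := Int.ediv_mul_cancel (hdvd (Finset.mem_filter.1 ha).2)
    have h2 := Int.ediv_mul_cancel (hdvd (Finset.mem_filter.1 hb).2)
    simp only at hab
    rw [← h1, ← h2, hab]

/-! ### Uniform choices and majority votes by counting. -/

section Uniform

open scoped Classical

lemma uniformOn_univ_real {A : Type*} [Fintype A] [Nonempty A] [MeasurableSpace A]
    [MeasurableSingletonClass A] (p : A → Prop) [DecidablePred p] :
    (uniformOn (Set.univ : Set A)).real {a | p a} =
      ((Finset.univ.filter p).card : ℝ) / Fintype.card A := by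
  rw [measureReal_def, uniformOn_univ, ENNReal.toReal_div,
    Measure.count_apply_finite _ {a | p a}.toFinite]
  simp only [ENNReal.toReal_natCast]
  congr 3
  ext a
  simp

/-- If an event has probability at most `1 / 16`, then it occurs in at least half of `t` independent
trials with probability at most `2 ^ (-t)`. -/
lemma card_majority_mul_le {A : Type*} [Fintype A] (B : A → Prop) (t : ℕ)
    (hB : 16 * (Finset.univ.filter B).card ≤ Fintype.card A) :
    (Finset.univ.filter fun x : Fin t → A =>
      t ≤ 2 * (Finset.univ.filter fun i => B (x i)).card).card * 2 ^ t ≤ Fintype.card A ^ t := by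
  -- An exponential moment argument: the mean of `w` is at most `2`, while a tuple with a bad
  -- majority has product at least `16 ^ (t / 2) = 4 ^ t`.
  set w : A → ℕ := fun a => if B a then 16 else 1 with hw
  have hsum : ∑ a, w a ≤ 2 * Fintype.card A := by
    have h1 : ∑ a, w a = 16 * (Finset.univ.filter B).card + (Finset.univ.filter (¬ B ·)).card := by
      simp [hw, Finset.sum_ite, mul_comm]
    have h2 := Finset.card_filter_add_card_filter_not (s := (Finset.univ : Finset A)) B
    rw [Finset.card_univ] at h2
    omega
  have hprod (x : Fin t → A) : ∏ i, w (x i) = 16 ^ (Finset.univ.filter fun i => B (x i)).card := by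
    simp [hw, Finset.prod_ite]
  set S := Finset.univ.filter fun x : Fin t → A =>
      t ≤ 2 * (Finset.univ.filter fun i => B (x i)).card with hS
  have h4 : S.card * 4 ^ t ≤ (2 * Fintype.card A) ^ t := by
    calc S.card * 4 ^ t = ∑ x ∈ S, 4 ^ t := by rw [Finset.sum_const, smul_eq_mul]
      _ ≤ ∑ x ∈ S, ∏ i, w (x i) := by
        refine Finset.sum_le_sum fun x hx => ?_
        rw [hprod, show (16 : ℕ) = 4 ^ 2 by norm_num, ← pow_mul]
        exact Nat.pow_le_pow_right (by norm_num) (Finset.mem_filter.1 hx).2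
      _ ≤ ∑ x : Fin t → A, ∏ i, w (x i) :=
        Finset.sum_le_sum_of_subset (Finset.subset_univ _)
      _ = (∑ a, w a) ^ t := (Fintype.sum_pow w t).symm
      _ ≤ _ := Nat.pow_le_pow_left hsum t
  refine Nat.le_of_mul_le_mul_right ?_ (pow_pos (two_pos : 0 < 2) t)
  calc S.card * 2 ^ t * 2 ^ t = S.card * 4 ^ t := by rw [mul_assoc, ← mul_pow]; norm_num
    _ ≤ _ := h4
    _ = _ := by rw [mul_pow, mul_comm]

end Uniform

/-- Two distinct vertices collide with small probability under a random multiplicative hash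
function. -/
lemma measureReal_multHash_eq_le {n K x y : ℕ} (hK : 0 < K) (hx : x < n) (hy : y < n)
    (hxy : x ≠ y) [Nonempty (Fin (hashPrime n - 1))] :
    (uniformOn (Set.univ : Set (Fin (hashPrime n - 1)))).real
      {a | multHash n K a x = multHash n K a y} ≤ 1 / (512 * K) := by
  have hp := lt_hashPrime n
  have h1 := card_collision_le (prime_hashPrime n) (m := 1024 * K) (by omega) (hx.trans hp)
    (hy.trans hp) hxy
  have hK' : (0 : ℝ) < K := by exact_mod_cast hK
  have hA : (0 : ℝ) < ((hashPrime n - 1 : ℕ) : ℝ) := by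
    have := (prime_hashPrime n).one_lt
    exact_mod_cast (by omega : 0 < hashPrime n - 1)
  rw [uniformOn_univ_real, Fintype.card_fin, div_le_iff₀ hA]
  have h2 : ((2 * ((hashPrime n - 1) / (1024 * K)) : ℕ) : ℝ) ≤
      1 / (512 * K) * ((hashPrime n - 1 : ℕ) : ℝ) := by
    have h3 : (((hashPrime n - 1) / (1024 * K) : ℕ) : ℝ) ≤
        ((hashPrime n - 1 : ℕ) : ℝ) / ((1024 * K : ℕ) : ℝ) := Nat.cast_div_le
    rw [Nat.cast_mul]
    calc ((2 : ℕ) : ℝ) * (((hashPrime n - 1) / (1024 * K) : ℕ) : ℝ)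
        ≤ ((2 : ℕ) : ℝ) * (((hashPrime n - 1 : ℕ) : ℝ) / ((1024 * K : ℕ) : ℝ)) := by gcongr
      _ = _ := by push_cast; field_simp; norm_num
  refine le_trans ?_ h2
  exact Nat.cast_le.2 h1

/-! ### Digits -/

lemma sum_digits_lt {B : ℕ} {D : ℕ → ℕ} (hD : ∀ j, D j < B) (N : ℕ) :
    ∑ j ∈ Finset.range N, D j * B ^ j < B ^ N := by
  induction N with
  | zero => simp
  | succ N ih =>
    rw [Finset.sum_range_succ, pow_succ]
    calc _ < B ^ N + D N * B ^ N := by omega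
      _ = (D N + 1) * B ^ N := by ring
      _ ≤ B * B ^ N := Nat.mul_le_mul_right _ (hD N)
      _ = _ := mul_comm _ _

lemma sum_digits_div_mod {B : ℕ} {D : ℕ → ℕ} (hD : ∀ j, D j < B) {N j : ℕ} (hj : j < N) :
    (∑ i ∈ Finset.range N, D i * B ^ i) / B ^ j % B = D j := by
  have hB : 0 < B := (Nat.zero_le _).trans_lt (hD 0)
  induction N with
  | zero => omega
  | succ N ih =>
    rw [Finset.sum_range_succ]
    rcases Nat.lt_succ_iff_lt_or_eq.1 hj with h | rfl
    · obtain ⟨r, rfl⟩ := Nat.exists_eq_add_of_lt h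
      rw [show D (j + r + 1) * B ^ (j + r + 1) = B ^ j * (B * (D (j + r + 1) * B ^ r)) by ring,
        Nat.add_mul_div_left _ _ (pow_pos hB j), Nat.add_mul_mod_self_left]
      exact ih h
    · rw [Nat.add_mul_div_right _ _ (pow_pos hB j), Nat.div_eq_of_lt (sum_digits_lt hD j),
        zero_add, Nat.mod_eq_of_lt (hD j)]

/-! ### The sketch of a graph -/

section Sketch

open scoped Classical

variable {n K : ℕ} {G : SimpleGraph (Fin n)}

lemma counterIndex_comm (K i r s : ℕ) : counterIndex K i r s = counterIndex K i s r := by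
  rw [counterIndex, counterIndex, min_comm, max_comm]

lemma edgeCode_comm (n u v : ℕ) : edgeCode n u v = edgeCode n v u := by
  rw [edgeCode, edgeCode, min_comm, max_comm]

lemma edgeWeight_comm (n K ω u v : ℕ) : edgeWeight n K ω u v = edgeWeight n K ω v u := by
  simp only [edgeWeight, edgeCode_comm n u v]
  exact Finset.sum_congr rfl fun i _ => by rw [counterIndex_comm]

/-- The contribution of an unordered pair of vertices to the sketch. -/
def pairWeight (n K ω : ℕ) : Sym2 (Fin n) → ℕ :=
  Sym2.lift ⟨fun u v => edgeWeight n K ω u v, fun _ _ => edgeWeight_comm _ _ _ _ _⟩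

/-- The code of an unordered pair of vertices. -/
def pairCode (n : ℕ) : Sym2 (Fin n) → ℕ :=
  Sym2.lift ⟨fun u v => edgeCode n u v, fun _ _ => edgeCode_comm _ _ _⟩

/-- The index of the counter of an unordered pair of hash values. -/
def pairIndex (K i : ℕ) : Sym2 (Fin (1024 * K)) → ℕ :=
  Sym2.lift ⟨fun r s => counterIndex K i r s, fun _ _ => counterIndex_comm _ _ _ _⟩

/-- The hash function with the multiplier `a + 1`. -/
def hashFun (n : ℕ) (hK : 0 < K) (a : ℕ) (v : Fin n) : Fin (1024 * K) :=
  ⟨multHash n K a v, Nat.mod_lt _ (by omega)⟩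

/-- The sketch of the graph `G` for the seed `ω`. -/
noncomputable def graphSketch (K ω : ℕ) (G : SimpleGraph (Fin n)) : ℕ :=
  ∑ e ∈ G.edgeFinset, pairWeight n K ω e

lemma pairWeight_eq (hK : 0 < K) (ω : ℕ) (e : Sym2 (Fin n)) :
    pairWeight n K ω e = ∑ i ∈ Finset.range (trialCount n K), pairCode n e *
      counterBase n ^ pairIndex K i (e.map (hashFun n hK (seedDigit n ω i))) := by
  induction e using Sym2.ind with
  | _ u v => rfl

lemma mul_add_inj {b x y x' y' : ℕ} (hy : y < b) (hy' : y' < b) (h : x * b + y = x' * b + y') :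
    x = x' ∧ y = y' := by
  have hb : 0 < b := by omega
  have h1 : (x * b + y) / b = (x' * b + y') / b := by rw [h]
  rw [mul_comm x, mul_comm x', Nat.mul_add_div hb, Nat.mul_add_div hb, Nat.div_eq_of_lt hy,
    Nat.div_eq_of_lt hy'] at h1
  have h2 : x = x' := by simpa using h1
  subst h2
  exact ⟨rfl, by omega⟩

lemma sym2_eq_of_min_max {N : ℕ} {a b c d : Fin N} (h1 : min (a : ℕ) b = min (c : ℕ) d)
    (h2 : max (a : ℕ) b = max (c : ℕ) d) : s(a, b) = s(c, d) := by
  rw [Sym2.eq_iff]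
  simp only [Fin.ext_iff]
  omega

lemma pairIndex_inj {i j : ℕ} {q q' : Sym2 (Fin (1024 * K))}
    (h : pairIndex K i q = pairIndex K j q') : i = j ∧ q = q' := by
  induction q using Sym2.ind with
  | _ r s =>
  induction q' using Sym2.ind with
  | _ r' s' =>
  have h' : counterIndex K i r s = counterIndex K j r' s' := h
  have := r.2
  have := s.2
  have := r'.2
  have := s'.2
  obtain ⟨h1, h2⟩ := mul_add_inj (by omega) (by omega) h'
  obtain ⟨h3, h4⟩ := mul_add_inj (by omega) (by omega) h1
  exact ⟨h3, sym2_eq_of_min_max h4 h2⟩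

lemma pairIndex_lt {i t : ℕ} (hi : i < t) (q : Sym2 (Fin (1024 * K))) :
    pairIndex K i q < t * (1024 * K) ^ 2 := by
  induction q using Sym2.ind with
  | _ r s =>
  show counterIndex K i r s < _
  have hr := r.2
  have hs := s.2
  rw [counterIndex]
  generalize 1024 * K = m at *
  have h1 : min (r : ℕ) s + 1 ≤ m := by omega
  have h2 : max (r : ℕ) s < m := by omega
  calc (i * m + min (r : ℕ) s) * m + max (r : ℕ) s < (i * m + min (r : ℕ) s + 1) * m := by
        rw [add_mul _ 1, one_mul]; omega
    _ ≤ (i * m + m) * m := Nat.mul_le_mul_right _ (by omega)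
    _ = (i + 1) * m ^ 2 := by ring
    _ ≤ _ := Nat.mul_le_mul_right _ hi

lemma le_pairCode (e : Sym2 (Fin n)) : n ^ 2 ≤ pairCode n e := by
  induction e using Sym2.ind with
  | _ u v => exact Nat.le_add_right _ _

lemma pairCode_lt (e : Sym2 (Fin n)) : pairCode n e < 2 * n ^ 2 := by
  induction e using Sym2.ind with
  | _ u v =>
  have hu := u.2
  have hv := v.2
  have h1 : min (u : ℕ) v + 1 ≤ n := by omega
  have h2 : max (u : ℕ) v < n := by omega
  have h3 : (min (u : ℕ) v + 1) * n ≤ n * n := Nat.mul_le_mul_right _ h1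
  show n ^ 2 + (min (u : ℕ) v * n + max (u : ℕ) v) < 2 * n ^ 2
  rw [sq]
  rw [add_mul, one_mul] at h3
  omega

lemma pairCode_injective : Function.Injective (pairCode n) := by
  intro e e' h
  induction e using Sym2.ind with
  | _ u v =>
  induction e' using Sym2.ind with
  | _ u' v' =>
  have h' : edgeCode n u v = edgeCode n u' v' := h
  have := u.2
  have := v.2
  have := u'.2
  have := v'.2
  obtain ⟨h1, h2⟩ := mul_add_inj (by omega) (by omega) (Nat.add_left_cancel h')
  exact sym2_eq_of_min_max h1 h2

/-- There are at most `n ^ 2` edges with codes below `2 * n ^ 2`, and `2 * n ^ 4 < 2 ^ (5 *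
vertexBits n)`. This choice of base rules out carries between counters for every graph, not only for
graphs with a small vertex cover. -/
lemma sum_pairCode_lt (G : SimpleGraph (Fin n)) :
    ∑ e ∈ G.edgeFinset, pairCode n e < counterBase n := by
  have hb : n < 2 ^ vertexBits n := Nat.lt_pow_succ_log_self (by norm_num) n
  have h2 : 2 ≤ 2 ^ vertexBits n := by
    have : 1 ≤ vertexBits n := by rw [vertexBits]; omega
    calc 2 = 2 ^ 1 := rfl
      _ ≤ _ := Nat.pow_le_pow_right (by norm_num) this
  have hE : G.edgeFinset.card ≤ n ^ 2 := by
    have := G.card_edgeFinset_le_card_choose_two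
    rw [Fintype.card_fin] at this
    exact this.trans (Nat.choose_le_pow n 2)
  calc ∑ e ∈ G.edgeFinset, pairCode n e ≤ G.edgeFinset.card * (2 * n ^ 2) := by
        rw [← smul_eq_mul]
        exact Finset.sum_le_card_nsmul _ _ _ fun e _ => (pairCode_lt e).le
    _ ≤ n ^ 2 * (2 * n ^ 2) := Nat.mul_le_mul_right _ hE
    _ = n ^ 4 * 2 := by ring
    _ < (2 ^ vertexBits n) ^ 4 * 2 ^ vertexBits n :=
        Nat.mul_lt_mul_of_lt_of_le (Nat.pow_lt_pow_left hb (by norm_num)) h2 (by norm_num)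
    _ = counterBase n := by rw [counterBase, ← pow_mul, ← pow_add]; congr 1; ring

/-- The values of the counters for the graph `G`. -/
noncomputable def counterValue (hK : 0 < K) (ω : ℕ) (G : SimpleGraph (Fin n)) (j : ℕ) : ℕ :=
  ∑ e ∈ G.edgeFinset, ∑ i ∈ Finset.range (trialCount n K),
    if pairIndex K i (e.map (hashFun n hK (seedDigit n ω i))) = j then pairCode n e else 0

/-- The index `j` determines the trial, so each edge contributes its code at most once. -/
lemma counterValue_lt (hK : 0 < K) (ω : ℕ) (G : SimpleGraph (Fin n)) (j : ℕ) :
    counterValue hK ω G j < counterBase n := by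
  refine lt_of_le_of_lt (Finset.sum_le_sum fun e _ => ?_) (sum_pairCode_lt G)
  rw [← Finset.sum_filter, Finset.sum_const, smul_eq_mul]
  refine (Nat.mul_le_mul_right _ (Finset.card_le_one.2 fun i hi i' hi' => ?_)).trans_eq
    (one_mul _)
  exact (pairIndex_inj ((Finset.mem_filter.1 hi).2.trans (Finset.mem_filter.1 hi').2.symm)).1

lemma graphSketch_eq (hK : 0 < K) (ω : ℕ) (G : SimpleGraph (Fin n)) :
    graphSketch K ω G = ∑ j ∈ Finset.range (trialCount n K * (1024 * K) ^ 2),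
      counterValue hK ω G j * counterBase n ^ j := by
  simp only [counterValue, Finset.sum_mul]
  rw [graphSketch, Finset.sum_comm]
  refine Finset.sum_congr rfl fun e _ => ?_
  rw [pairWeight_eq hK, Finset.sum_comm]
  refine Finset.sum_congr rfl fun i hi => ?_
  simp only [ite_mul, zero_mul]
  rw [Finset.sum_ite_eq, if_pos (Finset.mem_range.2 (pairIndex_lt (Finset.mem_range.1 hi) _))]

lemma graphSketch_lt (hK : 0 < K) (ω : ℕ) (G : SimpleGraph (Fin n)) :
    graphSketch K ω G < counterBase n ^ (trialCount n K * (1024 * K) ^ 2) := by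
  rw [graphSketch_eq hK]
  exact sum_digits_lt (counterValue_lt hK ω G) _

/-- The counter values are the true base-`counterBase n` digits of the sketch, so extracting a digit
gives the sum over one bucket exactly. -/
lemma counter_graphSketch (hK : 0 < K) (ω : ℕ) (G : SimpleGraph (Fin n)) {i : ℕ}
    (hi : i < trialCount n K) (q : Sym2 (Fin (1024 * K))) :
    counter n (graphSketch K ω G) (pairIndex K i q) =
      ∑ e ∈ G.edgeFinset.filter
        (· ∈ hashBucket G (hashFun n hK (seedDigit n ω i)) q), pairCode n e := by
  rw [counter, graphSketch_eq hK, sum_digits_div_mod (counterValue_lt hK ω G) (pairIndex_lt hi q),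
    counterValue, Finset.sum_filter]
  refine Finset.sum_congr rfl fun e he => ?_
  rw [Finset.sum_eq_single_of_mem i (Finset.mem_range.2 hi)]
  · refine if_congr ⟨fun h => ⟨SimpleGraph.mem_edgeFinset.1 he, (pairIndex_inj h).2⟩, fun h => ?_⟩
      rfl rfl
    rw [h.2]
  · intro j _ hj
    exact if_neg fun h => hj (pairIndex_inj h).1

lemma counter_eq_zero_iff (hK : 0 < K) (ω : ℕ) (G : SimpleGraph (Fin n)) {i : ℕ}
    (hi : i < trialCount n K) (q : Sym2 (Fin (1024 * K))) :
    counter n (graphSketch K ω G) (pairIndex K i q) = 0 ↔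
      ¬ (hashBucket G (hashFun n hK (seedDigit n ω i)) q).Nonempty := by
  rw [counter_graphSketch hK ω G hi, Finset.sum_eq_zero_iff, Set.not_nonempty_iff_eq_empty,
    Set.eq_empty_iff_forall_notMem]
  have hpos (e : Sym2 (Fin n)) : pairCode n e ≠ 0 := by
    have h := le_pairCode e
    have : 0 < n := by
      induction e using Sym2.ind with
      | _ u v => exact u.pos
    have : 0 < n ^ 2 := by positivity
    omega
  constructor
  · intro h e he
    exact hpos e (h e (Finset.mem_filter.2 ⟨SimpleGraph.mem_edgeFinset.2 he.1, he⟩))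
  · intro h e he
    exact absurd (Finset.mem_filter.1 he).2 (h e)

/-- Two codes already sum to at least `2 * n ^ 2`, more than any single code, and an empty sum is
too small. -/
lemma eq_singleton_of_sum_pairCode {S : Finset (Sym2 (Fin n))} {e : Sym2 (Fin n)}
    (h : ∑ x ∈ S, pairCode n x = pairCode n e) : S = {e} := by
  have h1 := pairCode_lt e
  have h2 := le_pairCode e
  have h3 : S.card * n ^ 2 ≤ ∑ x ∈ S, pairCode n x := by
    rw [← smul_eq_mul]
    exact Finset.card_nsmul_le_sum _ _ _ fun x _ => le_pairCode x
  have h4 : S.card < 2 := by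
    by_contra hcon
    have := Nat.mul_le_mul_right (n ^ 2) (not_lt.1 hcon)
    omega
  rcases (by omega : S.card = 0 ∨ S.card = 1) with h0 | h0
  · rw [Finset.card_eq_zero] at h0
    subst h0
    rw [Finset.sum_empty] at h
    omega
  · obtain ⟨x, rfl⟩ := Finset.card_eq_one.1 h0
    rw [Finset.sum_singleton] at h
    rw [pairCode_injective h]

/-- Recovery never produces a false edge, whatever the seed; randomness can only cause edges to be
missed. -/
lemma adj_of_isRecovered (hK : 0 < K) {ω : ℕ} {u v : Fin n}
    (h : IsRecovered n K ω (graphSketch K ω G) u v) : G.Adj u v := by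
  obtain ⟨i, hi, h⟩ := h
  have h1 := (counter_graphSketch hK ω G hi
    s(hashFun n hK (seedDigit n ω i) u, hashFun n hK (seedDigit n ω i) v)).symm.trans h
  have h2 := eq_singleton_of_sum_pairCode (e := s(u, v)) h1
  have h3 := (Finset.ext_iff.1 h2 s(u, v)).2 (Finset.mem_singleton_self _)
  exact SimpleGraph.mem_edgeFinset.1 (Finset.mem_filter.1 h3).1

lemma isRecovered_of_isGoodForEdge (hK : 0 < K) {ω : ℕ} {C : Finset (Fin n)}
    (hC : G.IsVertexCover (C : Set (Fin n))) {u v : Fin n} (huv : G.Adj u v) {i : ℕ}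
    (hi : i < trialCount n K)
    (hgood : IsGoodForEdge G C u v (hashFun n hK (seedDigit n ω i))) :
    IsRecovered n K ω (graphSketch K ω G) u v := by
  refine ⟨i, hi, ?_⟩
  have h1 := counter_graphSketch hK ω G hi
    s(hashFun n hK (seedDigit n ω i) u, hashFun n hK (seedDigit n ω i) v)
  rw [hashBucket_eq_singleton hC huv hgood.1 hgood.2] at h1
  refine h1.trans ((Finset.sum_congr ?_ fun _ _ => rfl).trans
    (Finset.sum_singleton (pairCode n) s(u, v)))
  ext e
  simp only [Finset.mem_filter, Set.mem_singleton_iff, Finset.mem_singleton,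
    SimpleGraph.mem_edgeFinset]
  refine ⟨fun h => h.2, ?_⟩
  rintro rfl
  exact ⟨huv, rfl⟩

lemma rowCount_graphSketch (hK : 0 < K) (ω : ℕ) (G : SimpleGraph (Fin n)) {i : ℕ}
    (hi : i < trialCount n K) (v : Fin n) :
    rowCount n K ω (graphSketch K ω G) i v =
      (occupiedRow G (hashFun n hK (seedDigit n ω i)) v).card := by
  rw [← Finset.card_map Fin.valEmbedding, rowCount]
  congr 1
  have key (r : Fin (1024 * K)) :
      counter n (graphSketch K ω G) (counterIndex K i (trialHash n K ω i v) r) ≠ 0 ↔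
        (hashBucket G (hashFun n hK (seedDigit n ω i))
          s(hashFun n hK (seedDigit n ω i) v, r)).Nonempty :=
    (not_congr (counter_eq_zero_iff hK ω G hi
      s(hashFun n hK (seedDigit n ω i) v, r))).trans not_not
  ext r
  simp only [occupiedRow, Finset.mem_filter, Finset.mem_range, Finset.mem_map, Finset.mem_univ,
    true_and, Fin.valEmbedding_apply]
  constructor
  · rintro ⟨hr, h⟩
    exact ⟨⟨r, hr⟩, (key ⟨r, hr⟩).1 h, rfl⟩
  · rintro ⟨r, h, rfl⟩
    exact ⟨r.2, (key r).2 h⟩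

/-! ### The answer computed from the sketch -/

/-- The set of vertices encoded by the bits of `x`. -/
noncomputable def maskSet (n x : ℕ) : Finset (Fin n) := Finset.univ.filter fun v => InMask x v

lemma mem_maskSet {x : ℕ} {v : Fin n} : v ∈ maskSet n x ↔ InMask x v := by
  simp [maskSet]

lemma toFinset_maskList (n x : ℕ) :
    (maskList n x).toFinset = (maskSet n x).map Fin.valEmbedding := by
  ext v
  simp only [maskList, maskSet, List.mem_toFinset, List.mem_filter, List.mem_range,
    decide_eq_true_eq, Finset.mem_map, Finset.mem_filter, Finset.mem_univ, true_and,
    Fin.valEmbedding_apply]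
  constructor
  · rintro ⟨hv, h⟩
    exact ⟨⟨v, hv⟩, h, rfl⟩
  · rintro ⟨v, h, rfl⟩
    exact ⟨v.2, h⟩

lemma length_maskList (n x : ℕ) : (maskList n x).length = (maskSet n x).card := by
  have h : (maskList n x).Nodup := List.nodup_range.filter _
  rw [← Finset.card_map Fin.valEmbedding, ← toFinset_maskList, List.toFinset_card_of_nodup h]

lemma exists_maskSet_eq (X : Finset (Fin n)) : ∃ x < 2 ^ n, maskSet n x = X := by
  refine ⟨∑ v ∈ X, 2 ^ (v : ℕ), ?_, ?_⟩
  · have h := Nat.geomSum_lt (m := 2) (n := n) (s := X.map Fin.valEmbedding) le_rfl (by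
      intro k hk
      obtain ⟨v, -, rfl⟩ := Finset.mem_map.1 hk
      exact v.2)
    simpa using h
  · ext v
    have h := sum_digits_div_mod (B := 2)
      (D := fun j => if j ∈ X.map Fin.valEmbedding then 1 else 0)
      (fun j => by split_ifs <;> norm_num) v.2
    have hs : ∑ i ∈ Finset.range n, (if i ∈ X.map Fin.valEmbedding then 1 else 0) * 2 ^ i =
        ∑ v ∈ X, 2 ^ (v : ℕ) := by
      simp only [ite_mul, one_mul, zero_mul]
      rw [← Finset.sum_filter, Finset.filter_mem_eq_inter, Finset.inter_eq_right.2,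
        Finset.sum_map]
      · rfl
      · intro k hk
        obtain ⟨w, -, rfl⟩ := Finset.mem_map.1 hk
        exact Finset.mem_range.2 w.2
    rw [hs] at h
    rw [mem_maskSet, InMask, h]
    simp [Fin.val_inj]

/-- If the sketch recovers all edges outside of a set of vertices of large degree, then the answer
is correct. -/
lemma correct_sketchAnswer {k ω σ : ℕ} {C : Finset (Fin n)}
    (hC : G.IsVertexCover (C : Set (Fin n))) (hCK : C.card ≤ K) (hkK : k ≤ K)
    (hrec : ∀ u v : Fin n, IsRecovered n K ω σ u v → G.Adj u v)
    (hlight : ∀ u v : Fin n, G.Adj u v → ¬ IsDeclaredHeavy n K ω σ u →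
      ¬ IsDeclaredHeavy n K ω σ v → IsRecovered n K ω σ u v)
    (hheavy : ∀ v : Fin n, IsDeclaredHeavy n K ω σ v → 2 * K < G.degree v) :
    clusterVertexDeletion.correct n K k G (sketchAnswer n K k ω σ) := by
  have hsymm (u v : Fin n) (h : IsRecovered n K ω σ u v) : IsRecovered n K ω σ v u := by
    obtain ⟨i, hi, h⟩ := h
    exact ⟨i, hi, by rw [counterIndex_comm, h, edgeCode_comm]⟩
  set F : SimpleGraph (Fin n) :=
    { Adj := fun u v => IsRecovered n K ω σ u v
      symm := ⟨fun u v h => hsymm u v h⟩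
      loopless := ⟨fun u h => G.irrefl (hrec u u h)⟩ } with hF
  -- The test on masks is the sparsification criterion with `W` the declared heavy vertices and `F`
  -- the recovered edges.
  have hiff (x : ℕ) : IsMaskSolution n K k ω σ x ↔
      (maskSet n x).card ≤ k ∧ IsClusterDeletionSet G (maskSet n x) := by
    rw [IsMaskSolution, length_maskList]
    refine and_congr_right fun hxk => ?_
    rw [isClusterDeletionSet_iff_of_sparsification (F := F)
      (W := {v : Fin n | IsDeclaredHeavy n K ω σ v}) hC hCK (hxk.trans hkK)
      (fun u v h => hrec u v h)
      hheavy hlight, isClusterDeletionSet_iff]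
    refine and_congr ⟨fun h v hv => mem_maskSet.2 (h v v.2 hv),
      fun h v hv hv' => mem_maskSet.1 (h ⟨v, hv⟩ hv')⟩ ⟨?_, ?_⟩
    · intro h u v w hu hv hw huv hvw huw
      rw [mem_maskSet] at hu hv hw
      exact h u u.2 v v.2 w w.2 hu hv hw huv hvw (fun h => huw (Fin.ext h))
    · intro h u hu v hv w hw hxu hxv hxw huv hvw huw
      exact h ⟨u, hu⟩ ⟨v, hv⟩ ⟨w, hw⟩ (by rwa [mem_maskSet]) (by rwa [mem_maskSet])
        (by rwa [mem_maskSet]) huv hvw (by simpa using huw)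
  rw [sketchAnswer]
  rcases hl : ((List.range (2 ^ n)).filter (IsMaskSolution n K k ω σ ·)).head? with _ | x
  · rw [List.head?_eq_none_iff, List.filter_eq_nil_iff] at hl
    rintro ⟨X, hXk, hX⟩
    obtain ⟨x, hx, rfl⟩ := exists_maskSet_eq X
    exact hl x (List.mem_range.2 hx) (by simpa using (hiff x).2 ⟨hXk, hX⟩)
  · have hx := List.mem_of_mem_head? (Option.mem_def.2 hl)
    have hx' : IsMaskSolution n K k ω σ x := by simpa using (List.mem_filter.1 hx).2
    exact ⟨maskSet n x, toFinset_maskList n x, (hiff x).1 hx'⟩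

end Sketch

/-! ### The memory content of the streaming algorithm -/

section Stream

open scoped Classical

variable {n K : ℕ} {G : SimpleGraph (Fin n)}

lemma graphSketch_eq_add {H : SimpleGraph (Fin n)} (K ω : ℕ) {e : Sym2 (Fin n)}
    (he : e ∉ G.edgeSet) (hH : H.edgeSet = insert e G.edgeSet) :
    graphSketch K ω H = graphSketch K ω G + pairWeight n K ω e := by
  have h : H.edgeFinset = insert e G.edgeFinset := by
    rw [← Finset.coe_inj, Finset.coe_insert, SimpleGraph.coe_edgeFinset,
      SimpleGraph.coe_edgeFinset, hH]
  rw [graphSketch, h, Finset.sum_insert (by rwa [SimpleGraph.mem_edgeFinset]), add_comm]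
  rfl

lemma graphSketch_sup_edge (K ω : ℕ) {u v : Fin n} (huv : u ≠ v) (hG : ¬ G.Adj u v) :
    graphSketch K ω (G ⊔ SimpleGraph.edge u v) = graphSketch K ω G + edgeWeight n K ω u v := by
  refine graphSketch_eq_add K ω (e := s(u, v)) hG ?_
  rw [SimpleGraph.edgeSet_sup, SimpleGraph.edgeSet_edge_of_ne huv, Set.union_singleton]

lemma deleteEdges_sup_edge {u v : Fin n} (h : G.Adj u v) :
    G.deleteEdges {s(u, v)} ⊔ SimpleGraph.edge u v = G := by
  ext a b
  rw [SimpleGraph.sup_adj, SimpleGraph.deleteEdges_adj, SimpleGraph.edge_adj,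
    Set.mem_singleton_iff, Sym2.eq_iff]
  constructor
  · rintro (h1 | ⟨⟨rfl, rfl⟩ | ⟨rfl, rfl⟩, -⟩)
    exacts [h1.1, h, h.symm]
  · intro hab
    by_cases h1 : (a = u ∧ b = v) ∨ (a = v ∧ b = u)
    · exact Or.inr ⟨by tauto, hab.ne⟩
    · exact Or.inl ⟨hab, h1⟩

/-- The truncated subtraction is exact, because the weight of a present edge is a summand of the
sketch. -/
lemma graphSketch_deleteEdges (K ω : ℕ) {u v : Fin n} (h : G.Adj u v) :
    graphSketch K ω (G.deleteEdges {s(u, v)}) = graphSketch K ω G - edgeWeight n K ω u v := by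
  have h1 := graphSketch_sup_edge (G := G.deleteEdges {s(u, v)}) K ω h.ne (by simp)
  rw [deleteEdges_sup_edge h] at h1
  rw [h1, Nat.add_sub_cancel]

lemma run_sketchAlgorithm {s : List StreamToken} (hs : IsDynamicStream s G) (K k ω : ℕ) :
    sketchAlgorithm.run (n, K, k) ω s = Nat.pair ω (graphSketch K ω G) := by
  induction hs with
  | nil =>
    have h : graphSketch K ω (⊥ : SimpleGraph (Fin n)) = 0 :=
      Finset.sum_eq_zero fun e he => by simp at he
    rw [h]
    rfl
  | insert u v _ huv hG ih =>
    rw [StreamingAlgorithm.run] at ih ⊢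
    rw [List.foldl_append, ih, graphSketch_sup_edge K ω huv hG]
    simp [sketchAlgorithm]
  | delete u v _ hG ih =>
    rw [StreamingAlgorithm.run] at ih ⊢
    rw [List.foldl_append, ih, graphSketch_deleteEdges K ω hG]
    simp [sketchAlgorithm]

/-- The memory bound is needed at all times. Intermediate graphs may have large vertex covers, so
nothing is claimed about them. -/
lemma IsDynamicStream.exists_of_prefix {s t : List StreamToken} (hs : IsDynamicStream s G)
    (hts : t <+: s) : ∃ G' : SimpleGraph (Fin n), IsDynamicStream t G' := by
  induction hs with
  | nil =>
    rw [List.prefix_nil.1 hts]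
    exact ⟨⊥, .nil⟩
  | insert u v h huv hG ih =>
    rcases List.prefix_concat_iff.1 hts with rfl | h'
    · exact ⟨_, .insert u v h huv hG⟩
    · exact ih h'
  | delete u v h hG ih =>
    rcases List.prefix_concat_iff.1 hts with rfl | h'
    · exact ⟨_, .delete u v h hG⟩
    · exact ih h'

lemma size_pair_le {a b M : ℕ} (ha : a < 2 ^ M) (hb : b < 2 ^ M) : (Nat.pair a b).size ≤ 2 * M := by
  rw [Nat.size_le]
  calc Nat.pair a b < (max a b + 1) ^ 2 := Nat.pair_lt_max_add_one_sq a b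
    _ ≤ (2 ^ M) ^ 2 := Nat.pow_le_pow_left (max_lt ha hb) 2
    _ = _ := by rw [← pow_mul, mul_comm]

/-- Here the space bound is zero, so not even a seed may be stored. This is why there are no trials
for `K = 0`, and why `hashPrime n = 2`, with a single multiplier, matters for `n < 2`. -/
lemma pair_graphSketch_eq_zero (h : n < 2 ∨ K = 0) {ω : ℕ}
    (hω : ω < (hashPrime n - 1) ^ trialCount n K) :
    Nat.pair ω (graphSketch K ω G) = 0 := by
  have hω0 : ω = 0 := by
    have : (hashPrime n - 1) ^ trialCount n K = 1 := by
      rcases h with h | h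
      · have h1 := hashPrime_le n
        have h2 := (prime_hashPrime n).two_le
        rw [show hashPrime n - 1 = 1 by omega, one_pow]
      · rw [trialCount, if_pos h, pow_zero]
    omega
  have hσ0 : graphSketch K ω G = 0 := by
    rcases h with h | h
    · have : Subsingleton (Fin n) := Fin.subsingleton_iff_le_one.2 (by omega)
      rw [Subsingleton.elim G ⊥]
      simp [graphSketch]
    · refine Finset.sum_eq_zero fun e _ => ?_
      induction e using Sym2.ind with
      | _ u v => simp [pairWeight, edgeWeight, trialCount, h]
  rw [hω0] at hσ0 ⊢
  rw [hσ0]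
  rfl

/-- The sketch has `5 ℓ * (1024 * K) ^ 2` digits of `5 ℓ` bits, the seed fits into the same length
`M`, and pairing at most doubles it. The result is in fact quadratic in the logarithm, and is
weakened to the fourth power at the end. -/
lemma size_pair_graphSketch_le {ω : ℕ} (hω : ω < (hashPrime n - 1) ^ trialCount n K) :
    ((Nat.pair ω (graphSketch K ω G)).size : ℝ) ≤
      (200 * 1024 ^ 2) * ((K : ℝ) ^ 2 * Real.logb 2 (n : ℝ) ^ 4) := by
  by_cases h : n < 2 ∨ K = 0
  · rw [pair_graphSketch_eq_zero h hω, Nat.size_zero, Nat.cast_zero]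
    positivity
  · obtain ⟨hn, hK⟩ := not_or.1 h
    have hK : 0 < K := Nat.pos_of_ne_zero hK
    have hn : 2 ≤ n := not_lt.1 hn
    set ℓ := vertexBits n with hℓ
    set M := 5 * ℓ * (trialCount n K * (1024 * K) ^ 2) with hM
    have hσ : graphSketch K ω G < 2 ^ M := by
      have := graphSketch_lt hK ω G
      rwa [counterBase, ← pow_mul] at this
    have hω' : ω < 2 ^ M := by
      have h1 : hashPrime n - 1 ≤ 2 ^ (ℓ + 1) := by
        have h2 : n < 2 ^ ℓ := Nat.lt_pow_succ_log_self (by norm_num) n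
        have h3 := hashPrime_le n
        rw [pow_succ]
        omega
      have h4 : 1 ≤ ℓ := by rw [hℓ, vertexBits]; omega
      have h5 : 1 ≤ (1024 * K) ^ 2 := Nat.one_le_pow _ _ (by omega)
      calc ω < (hashPrime n - 1) ^ trialCount n K := hω
        _ ≤ (2 ^ (ℓ + 1)) ^ trialCount n K := Nat.pow_le_pow_left h1 _
        _ = 2 ^ ((ℓ + 1) * trialCount n K) := by rw [← pow_mul]
        _ ≤ 2 ^ M := by
          refine Nat.pow_le_pow_right (by norm_num) (Nat.mul_le_mul (by omega) ?_)
          exact Nat.le_mul_of_pos_right _ h5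
    have hsize := size_pair_le hω' hσ
    have hlog : (1 : ℝ) ≤ Real.logb 2 n := by
      rw [Real.le_logb_iff_rpow_le (by norm_num) (by positivity), Real.rpow_one]
      exact_mod_cast hn
    have hℓ' : (ℓ : ℝ) ≤ 2 * Real.logb 2 n := by
      have := Real.natLog_le_logb n 2
      rw [hℓ, vertexBits]
      push_cast at this ⊢
      linarith
    have hM' : (M : ℝ) = 25 * (ℓ : ℝ) ^ 2 * (1024 * K) ^ 2 := by
      rw [hM, trialCount, if_neg hK.ne', ← hℓ]
      push_cast
      ring
    calc ((Nat.pair ω (graphSketch K ω G)).size : ℝ) ≤ ((2 * M : ℕ) : ℝ) := by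
          exact_mod_cast hsize
      _ = 50 * (ℓ : ℝ) ^ 2 * (1024 * K) ^ 2 := by push_cast; rw [hM']; ring
      _ ≤ 50 * (2 * Real.logb 2 n) ^ 2 * (1024 * K) ^ 2 := by gcongr
      _ = (200 * 1024 ^ 2) * ((K : ℝ) ^ 2 * Real.logb 2 (n : ℝ) ^ 2) := by ring
      _ ≤ (200 * 1024 ^ 2) * ((K : ℝ) ^ 2 * Real.logb 2 (n : ℝ) ^ 4) := by
        gcongr
        norm_num

end Stream

/-! ### The success probability of the streaming algorithm -/

section Success

open scoped Classical

variable {n K : ℕ} {G : SimpleGraph (Fin n)} {C : Finset (Fin n)}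

lemma card_exists_majority_mul_le {A Z : Type*} [Fintype A] [Fintype Z] (B : Z → A → Prop) (t : ℕ)
    (hB : ∀ z, 16 * (Finset.univ.filter (B z)).card ≤ Fintype.card A) :
    (Finset.univ.filter fun x : Fin t → A =>
      ∃ z, t ≤ 2 * (Finset.univ.filter fun i => B z (x i)).card).card * 2 ^ t ≤
      Fintype.card Z * Fintype.card A ^ t := by
  have hsub : (Finset.univ.filter fun x : Fin t → A =>
      ∃ z, t ≤ 2 * (Finset.univ.filter fun i => B z (x i)).card) ⊆
      Finset.univ.biUnion fun z => Finset.univ.filter fun x : Fin t → A =>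
        t ≤ 2 * (Finset.univ.filter fun i => B z (x i)).card := by
    intro x hx
    simpa using hx
  calc _ ≤ (∑ z : Z, (Finset.univ.filter fun x : Fin t → A =>
        t ≤ 2 * (Finset.univ.filter fun i => B z (x i)).card).card) * 2 ^ t :=
        Nat.mul_le_mul_right _ ((Finset.card_le_card hsub).trans Finset.card_biUnion_le)
    _ ≤ ∑ _z : Z, Fintype.card A ^ t := by
        rw [Finset.sum_mul]
        exact Finset.sum_le_sum fun z _ => card_majority_mul_le (B z) t (hB z)
    _ = _ := by rw [Finset.sum_const, smul_eq_mul, Finset.card_univ]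

lemma sixteen_mul_card_le {A : Type*} [Fintype A] [Nonempty A] [MeasurableSpace A]
    [MeasurableSingletonClass A] (p : A → Prop)
    (hp : (uniformOn (Set.univ : Set A)).real {a | p a} ≤ 1 / 16) :
    16 * (Finset.univ.filter p).card ≤ Fintype.card A := by
  rw [uniformOn_univ_real, div_le_iff₀ (by exact_mod_cast Fintype.card_pos)] at hp
  have : (16 * (Finset.univ.filter p).card : ℝ) ≤ Fintype.card A := by linarith
  exact_mod_cast this

/-- The bad multipliers for a pair of vertices or for a vertex. -/
def IsBadMultiplier (hK : 0 < K) (G : SimpleGraph (Fin n)) (C : Finset (Fin n))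
    (S : Fin n → Finset (Fin n)) : (Fin n × Fin n) ⊕ Fin n → ℕ → Prop
  | .inl (u, v), a => (G.Adj u v ∧ G.degree u ≤ 5 * K ∧ G.degree v ≤ 5 * K) ∧
      ¬ IsGoodForEdge G C u v (hashFun n hK a)
  | .inr u, a => if 5 * K < G.degree u then ¬ IsGoodForHeavy K C (S u) u (hashFun n hK a)
      else ¬ HashIsolated (hashFun n hK a) C u

lemma sixteen_mul_card_isBadMultiplier_le (hK : 0 < K) (hCK : C.card ≤ K)
    {S : Fin n → Finset (Fin n)} (hS : ∀ u, 5 * K < G.degree u → (S u).card = 4 * K + 1)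
    (z : (Fin n × Fin n) ⊕ Fin n) :
    16 * (Finset.univ.filter fun a : Fin (hashPrime n - 1) =>
      IsBadMultiplier hK G C S z a).card ≤ hashPrime n - 1 := by
  have hq : 0 < hashPrime n - 1 := by
    have := (prime_hashPrime n).two_le
    omega
  have : Nonempty (Fin (hashPrime n - 1)) := ⟨⟨0, hq⟩⟩
  have hprob : IsProbabilityMeasure (uniformOn (Set.univ : Set (Fin (hashPrime n - 1)))) :=
    isProbabilityMeasure_uniformOn Set.finite_univ Set.univ_nonempty
  have hmeas : Measurable fun (a : Fin (hashPrime n - 1)) => hashFun n hK (a : ℕ) :=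
    Measurable.of_discrete
  have hκ : ∀ u v : Fin n, u ≠ v → (uniformOn (Set.univ : Set (Fin (hashPrime n - 1)))).real
      {a | hashFun n hK (a : ℕ) u = hashFun n hK (a : ℕ) v} ≤ 1 / (512 * K) := by
    intro u v huv
    have h := measureReal_multHash_eq_le hK u.2 v.2 (fun h => huv (Fin.ext h))
    simpa only [hashFun, Fin.ext_iff] using h
  have h := sixteen_mul_card_le (fun a : Fin (hashPrime n - 1) => IsBadMultiplier hK G C S z a) ?_
  · rwa [Fintype.card_fin] at h
  rcases z with ⟨u, v⟩ | u
  · by_cases hz : G.Adj u v ∧ G.degree u ≤ 5 * K ∧ G.degree v ≤ 5 * K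
    · refine (measureReal_mono (fun a ha => ha.2) (measure_ne_top _ _)).trans
        (measureReal_not_isGoodForEdge_le hK hκ hCK hz.2.1 hz.2.2)
    · have : {a : Fin (hashPrime n - 1) | IsBadMultiplier hK G C S (.inl (u, v)) a} = ∅ := by
        ext a
        simp only [IsBadMultiplier, Set.mem_ofPred_eq, Set.mem_empty_iff_false, iff_false]
        tauto
      rw [this, measureReal_empty]
      norm_num
  · by_cases hu : 5 * K < G.degree u
    · simp only [IsBadMultiplier, if_pos hu]
      exact measureReal_not_isGoodForHeavy_le hK hmeas hκ hCK (hS u hu) u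
    · simp only [IsBadMultiplier, if_neg hu]
      exact (measureReal_not_hashIsolated_cover_le hK hκ hCK u).trans (by norm_num)

lemma card_filter_range_eq (t : ℕ) (p : ℕ → Prop) [DecidablePred p] :
    ((Finset.range t).filter p).card =
      (Finset.univ.filter fun i : Fin t => p i).card := by
  rw [← Finset.card_map Fin.valEmbedding]
  congr 1
  ext i
  simp only [Finset.mem_filter, Finset.mem_range, Finset.mem_map, Finset.mem_univ, true_and,
    Fin.valEmbedding_apply]
  constructor
  · rintro ⟨hi, h⟩
    exact ⟨⟨i, hi⟩, h, rfl⟩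
  · rintro ⟨j, h, rfl⟩
    exact ⟨j.2, h⟩

/-- The answer is correct if no pair of vertices and no vertex has a majority of bad multipliers. -/
lemma correct_of_minority_bad {k ω : ℕ} (hK : 0 < K) (hkK : k ≤ K)
    (hC : G.IsVertexCover (C : Set (Fin n))) (hCK : C.card ≤ K) {S : Fin n → Finset (Fin n)}
    (hS : ∀ u, 5 * K < G.degree u → S u ⊆ G.neighborFinset u \ C)
    (hgood : ∀ z, 2 * (Finset.univ.filter fun i : Fin (trialCount n K) =>
      IsBadMultiplier hK G C S z (seedDigit n ω i)).card < trialCount n K) :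
    clusterVertexDeletion.correct n K k G
      (sketchAnswer n K k ω (graphSketch K ω G)) := by
  have hheavy (u : Fin n) (hu : 5 * K < G.degree u) :
      IsDeclaredHeavy n K ω (graphSketch K ω G) u := by
    rw [IsDeclaredHeavy, card_filter_range_eq]
    have h1 := hgood (.inr u)
    have h2 := Finset.card_filter_add_card_filter_not
      (s := (Finset.univ : Finset (Fin (trialCount n K))))
      (fun i => IsBadMultiplier hK G C S (.inr u) (seedDigit n ω i))
    rw [Finset.card_univ, Fintype.card_fin] at h2
    have h3 : (Finset.univ.filter fun i : Fin (trialCount n K) =>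
        ¬ IsBadMultiplier hK G C S (.inr u) (seedDigit n ω i)).card ≤
        (Finset.univ.filter fun i : Fin (trialCount n K) =>
          3 * K < rowCount n K ω (graphSketch K ω G) i u).card := by
      refine Finset.card_le_card fun i hi => ?_
      have hi' := (Finset.mem_filter.1 hi).2
      simp only [IsBadMultiplier, if_pos hu, not_not] at hi'
      refine Finset.mem_filter.2 ⟨Finset.mem_univ _, ?_⟩
      rw [rowCount_graphSketch hK ω G i.2]
      exact hi'.2.trans_le (card_isolated_le_card_occupiedRow Finset.subset_union_right
        ((hS u hu).trans Finset.sdiff_subset))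
    omega
  refine correct_sketchAnswer hC hCK hkK (fun u v h => adj_of_isRecovered hK h) ?_ ?_
  · intro u v huv hu hv
    have hu' : G.degree u ≤ 5 * K := not_lt.1 fun h => hu (hheavy u h)
    have hv' : G.degree v ≤ 5 * K := not_lt.1 fun h => hv (hheavy v h)
    -- One good trial is enough for an edge, as recovery has no false positives.
    have hex : ∃ i : Fin (trialCount n K),
        ¬ IsBadMultiplier hK G C S (.inl (u, v)) (seedDigit n ω i) := by
      by_contra hcon
      push Not at hcon
      have h1 := hgood (.inl (u, v))
      rw [Finset.filter_true_of_mem fun i _ => hcon i, Finset.card_univ, Fintype.card_fin] at h1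
      omega
    obtain ⟨i, hi⟩ := hex
    refine isRecovered_of_isGoodForEdge hK hC huv i.2 ?_
    by_contra hcon
    exact hi ⟨⟨huv, hu', hv'⟩, hcon⟩
  · intro v hv
    by_contra hdeg
    rw [not_lt] at hdeg
    rw [IsDeclaredHeavy, card_filter_range_eq] at hv
    have h1 := hgood (.inr v)
    -- If `v` has degree at most `2 K`, its row exceeds `3 K` only in trials where `v` collides with
    -- the cover, so each vote for heaviness is a bad trial.
    have h3 : (Finset.univ.filter fun i : Fin (trialCount n K) =>
          3 * K < rowCount n K ω (graphSketch K ω G) i v).card ≤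
        (Finset.univ.filter fun i : Fin (trialCount n K) =>
          IsBadMultiplier hK G C S (.inr v) (seedDigit n ω i)).card := by
      refine Finset.card_le_card fun i hi => ?_
      have hi' := (Finset.mem_filter.1 hi).2
      rw [rowCount_graphSketch hK ω G i.2] at hi'
      refine Finset.mem_filter.2 ⟨Finset.mem_univ _, ?_⟩
      simp only [IsBadMultiplier, if_neg (show ¬ 5 * K < G.degree v by omega)]
      intro hiso
      have := card_occupiedRow_le hC hiso
      omega
    omega

/-- There are `n * n + n` events to control, each of probability at most `2 ^ (-t)`; their total
must not exceed `1 / 3`. -/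
lemma three_mul_sq_add_le {t : ℕ} (ht : t = 5 * vertexBits n) : 3 * (n * n + n) ≤ 2 ^ t := by
  have hb : n + 1 ≤ 2 ^ vertexBits n := Nat.lt_pow_succ_log_self (by norm_num) n
  calc 3 * (n * n + n) ≤ (n + 1) ^ 5 := by
        rcases Nat.eq_zero_or_pos n with rfl | hn
        · norm_num
        · have h1 : 2 ^ 3 ≤ (n + 1) ^ 3 := Nat.pow_le_pow_left (by omega) 3
          calc 3 * (n * n + n) ≤ 2 ^ 3 * (n + 1) ^ 2 := by nlinarith
            _ ≤ (n + 1) ^ 3 * (n + 1) ^ 2 := Nat.mul_le_mul_right _ h1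
            _ = (n + 1) ^ 5 := by ring
    _ ≤ (2 ^ vertexBits n) ^ 5 := Nat.pow_le_pow_left hb 5
    _ = 2 ^ t := by rw [← pow_mul, ht, mul_comm]

lemma seedDigit_finFunctionFinEquiv {t : ℕ} (x : Fin t → Fin (hashPrime n - 1)) (i : Fin t) :
    seedDigit n (finFunctionFinEquiv x) i = x i := by
  conv_rhs => rw [← finFunctionFinEquiv.symm_apply_apply x]
  rfl

/-- At least two thirds of the seeds lead to a correct answer. -/
lemma two_thirds_le_ncard_correct {k : ℕ} (hG : G.vertexCoverNum ≤ K) (hkK : k ≤ K) :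
    (2 / 3 : ℝ) ≤ ({ω : ℕ | ω < (hashPrime n - 1) ^ trialCount n K ∧
        clusterVertexDeletion.correct n K k G
          (sketchAnswer n K k ω (graphSketch K ω G))}.ncard : ℝ) /
      (((hashPrime n - 1) ^ trialCount n K : ℕ) : ℝ) := by
  obtain ⟨C, hC, hCK⟩ := exists_finset_isVertexCover hG
  set q := hashPrime n - 1 with hq
  set t := trialCount n K with ht
  have hq0 : 0 < q := by
    have := (prime_hashPrime n).two_le
    omega
  have hqt : (0 : ℝ) < ((q ^ t : ℕ) : ℝ) := by exact_mod_cast pow_pos hq0 t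
  set T : Set ℕ := {ω : ℕ | ω < q ^ t ∧ clusterVertexDeletion.correct n K k G
    (sketchAnswer n K k ω (graphSketch K ω G))} with hT
  have hTfin : T.Finite := (Set.finite_lt_nat (q ^ t)).subset fun ω hω => hω.1
  rw [le_div_iff₀ hqt]
  suffices h : 2 * q ^ t ≤ 3 * T.ncard by
    have h' : (2 * (q ^ t : ℕ) : ℝ) ≤ 3 * T.ncard := by exact_mod_cast h
    linarith
  rcases Nat.eq_zero_or_pos K with hK | hK
  · have ht0 : t = 0 := by rw [ht, trialCount, if_pos hK]
    have hT1 : T = {0} := by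
      ext ω
      simp only [hT, ht0, pow_zero, Nat.lt_one_iff, Set.mem_ofPred_eq, Set.mem_singleton_iff,
        and_iff_left_iff_imp]
      rintro -
      refine correct_sketchAnswer hC hCK hkK ?_ ?_ ?_
      · rintro u v ⟨i, hi, -⟩
        omega
      · intro u v huv
        exact absurd (pos_of_adj hC hCK huv) (by omega)
      · intro v hv
        rw [IsDeclaredHeavy, ← ht, ht0] at hv
        simp at hv
    rw [hT1, Set.ncard_singleton, ht0, pow_zero]
    norm_num
  · have hSex : ∀ u, ∃ S : Finset (Fin n), 5 * K < G.degree u →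
        S ⊆ G.neighborFinset u \ C ∧ S.card = 4 * K + 1 := by
      intro u
      by_cases hu : 5 * K < G.degree u
      · obtain ⟨S, h1, h2⟩ := exists_neighbors_outside hCK hu
        exact ⟨S, fun _ => ⟨h1, h2⟩⟩
      · exact ⟨∅, fun h => absurd h hu⟩
    choose S hSN using hSex
    set Bad := Finset.univ.filter fun x : Fin t → Fin q =>
      ∃ z, t ≤ 2 * (Finset.univ.filter fun i => IsBadMultiplier hK G C S z (x i)).card with hBad
    have hBadcard : 3 * Bad.card ≤ q ^ t := by
      have h1 := card_exists_majority_mul_le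
        (fun z (a : Fin q) => IsBadMultiplier hK G C S z a) t (fun z => by
          rw [Fintype.card_fin]
          exact sixteen_mul_card_isBadMultiplier_le hK hCK (fun u hu => (hSN u hu).2) z)
      rw [Fintype.card_fin, Fintype.card_sum, Fintype.card_prod, Fintype.card_fin] at h1
      have h2 := three_mul_sq_add_le (n := n) (t := t) (by rw [ht, trialCount, if_neg hK.ne'])
      refine Nat.le_of_mul_le_mul_right ?_ (pow_pos (two_pos : 0 < 2) t)
      calc 3 * Bad.card * 2 ^ t = 3 * (Bad.card * 2 ^ t) := by ring
        _ ≤ 3 * ((n * n + n) * q ^ t) := Nat.mul_le_mul_left _ h1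
        _ = 3 * (n * n + n) * q ^ t := by ring
        _ ≤ 2 ^ t * q ^ t := Nat.mul_le_mul_right _ h2
        _ = q ^ t * 2 ^ t := mul_comm _ _
    -- Seeds below `q ^ t` correspond to `t`-tuples of multipliers through their base-`q` digits, so
    -- a uniform seed makes the trials independent.
    have hsub : (((Badᶜ).image fun x => ((finFunctionFinEquiv x : Fin (q ^ t)) : ℕ) :
        Finset ℕ) : Set ℕ) ⊆ T := by
      intro ω hω
      obtain ⟨x, hx, rfl⟩ := Finset.mem_image.1 (Finset.mem_coe.1 hω)
      refine ⟨(finFunctionFinEquiv x).2,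
        correct_of_minority_bad hK hkK hC hCK (fun u hu => (hSN u hu).1) fun z => ?_⟩
      simp only [hBad, Finset.mem_compl, Finset.mem_filter, Finset.mem_univ, true_and,
        not_exists, not_le] at hx
      have e (i : Fin t) : seedDigit n (finFunctionFinEquiv x : Fin (q ^ t)) i = x i :=
        seedDigit_finFunctionFinEquiv x i
      show 2 * (Finset.univ.filter fun i : Fin t => IsBadMultiplier hK G C S z
        (seedDigit n (finFunctionFinEquiv x : Fin (q ^ t)) i)).card < t
      simp only [e]
      exact hx z
    have hcard : q ^ t - Bad.card ≤ T.ncard := by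
      calc q ^ t - Bad.card = (Badᶜ).card := by
            rw [Finset.card_compl, Fintype.card_fun, Fintype.card_fin, Fintype.card_fin]
        _ = ((Badᶜ).image fun x => ((finFunctionFinEquiv x : Fin (q ^ t)) : ℕ)).card :=
            (Finset.card_image_of_injective _
              (Fin.val_injective.comp finFunctionFinEquiv.injective)).symm
        _ ≤ T.ncard := by
            rw [← Set.ncard_coe_finset]
            exact Set.ncard_le_ncard hsub hTfin
    omega

theorem isDEAStreamable_clusterVertexDeletion : IsDEAStreamable clusterVertexDeletion
    (fun n K => (K : ℝ) ^ 2 * Real.logb 2 (n : ℝ) ^ 4) := by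
  refine ⟨sketchAlgorithm, 200 * 1024 ^ 2, fun n K k G s hG hs => ⟨fun ω hω t ht => ?_, ?_⟩⟩
  · obtain ⟨G', hG'⟩ := hs.exists_of_prefix ht
    rw [run_sketchAlgorithm hG']
    exact size_pair_graphSketch_le hω
  · have h := two_thirds_le_ncard_correct (k := k) hG.1 hG.2
    simp only [run_sketchAlgorithm hs]
    simpa only [sketchAlgorithm, Nat.unpair_pair] using h

end Success

theorem mainTheorem3 :
    -- streamability in the dynamic edge arrival model
    IsDEAStreamable clusterVertexDeletion
      (fun n K => (K : ℝ) ^ 2 * Real.logb 2 (n : ℝ) ^ 4) ∧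
    -- the sampled graph has, with high probability, the same small cluster deletion sets
    (∀ c : ℕ, ∃ α β c' : ℕ, 0 < α ∧ 0 < β ∧
      ∀ (n K : ℕ) (G : SimpleGraph (Fin n)), G.vertexCoverNum ≤ K →
      ∀ (Ω : Type) [MeasurableSpace Ω] (P : Measure Ω) [IsProbabilityMeasure P]
        (h : Fin (α * Nat.log 2 n) → Ω → Fin n → Fin (β * K))
        (L : Fin (α * Nat.log 2 n) → Sym2 (Fin (β * K)) → Ω → Option (Sym2 (Fin n))),
        IsEdgeSampling P G (1 / (n : ℝ) ^ c') h L →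
        1 - 1 / (n : ℝ) ^ c ≤
          P.real {ω | ∀ X : Finset (Fin n), X.card ≤ K →
            (IsClusterDeletionSet (sampledGraph L ω) X ↔ IsClusterDeletionSet G X)}) :=
  ⟨isDEAStreamable_clusterVertexDeletion, exists_sampling_parameters⟩
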